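/- A Reeb graph $(X,f)$ is a finite graph $X$ (parallel edges allowed) with a continuous $f:X\to\mathbb R$ that is strictly monotone on every edge; $V(X)$ is its vertex set. Every edge at a vertex $v$ goes up or down from $v$; write the numbers of these as (down-degree, up-degree). The graph is generic if $f$ is injective on $V(X)$ and every vertex is a local minimum $(0,1)$, an up-fork $(1,2)$, a down-fork $(2,1)$ or a local maximum $(1,0)$. For $\varepsilon>0$ let $S_\varepsilon(X,f)$ be the quotient $q$ of $X\times[-\varepsilon,\varepsilon]$ that identifies two points if they lie in the same path component of a level set of $(x,t)\mapsto f(x)+t$, with the induced function $f_\varepsilon$. Let $a_1<\dots<a_n$ be the values of $f$ on $V(X)$, and let $\mathrm{Ext}_1$ be the multiset of points $(a_i,a_j)$ that correspond to the intervals born at $H_1(X_{a_i})$ and dying entering $H_1(X,X^{a_j})$ in the extended persistence module (over a fixed field) $$0\to H_1(X_{a_1})\to\cdots\to H_1(X_{a_n})=H_1(X)\to H_1(X,X^{a_n})\to\cdots\to H_1(X,X^{a_1})=0,$$ where $X_a=f^{-1}(-\infty,a]$ and $X^a=f^{-1}[a,\infty)$. **Theorem.** Let $(X,f)$ be a generic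 Reeb graph and let $\varepsilon>0$ be such that $2\varepsilon\neq|a_i-a_j|$ for all $i,j$. Let $W\subseteq V(X)$ be the set of vertices $w$ that contribute to a point of $\mathrm{Ext}_1$ of lifetime at most $2\varepsilon$, i.e. such that there is a point $(a,b)\in\mathrm{Ext}_1$ with $|a-b|\le 2\varepsilon$ and $f(w)\in\{a,b\}$. Then $S_\varepsilon(X,f)$ is (up to a homeomorphism that preserves the functions) again a generic Reeb graph, and there is a bijection $$\Phi:V(X)\setminus W\to V(S_\varepsilon(X,f))$$ such that $\Phi(v)=q(v,-\varepsilon)$, at height $f(v)-\varepsilon$, if $v$ is a local minimum or a down-fork, and $\Phi(v)=q(v,\varepsilon)$, at height $f(v)+\varepsilon$, if $v$ is a local maximum or an up-fork. Moreover $\Phi(v)$ has the same down-degree and up-degree as $v$. -/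

import Mathlib

universe u w

/-- Combinatorial data of a Reeb graph: a finite multigraph (parallel edges allowed) with a real
height on the vertices, such that the two ends of every edge have different heights.
`lo e` and `hi e` are the lower and the upper end of the edge `e`. -/
structure ReebGraph where
  V : Type u
  E : Type u
  fintypeV : Fintype V
  fintypeE : Fintype E
  f : V → ℝ
  lo : E → V
  hi : E → V
  lo_lt_hi : ∀ e, f (lo e) < f (hi e)

namespace ReebGraph

attribute [instance] fintypeV fintypeE

variable (G : ReebGraph.{u})

/-! ### Degrees, vertex types, genericity -/

/-- Number of edges at `v` that go up from `v`. -/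
noncomputable def upDegree (v : G.V) : ℕ := Nat.card {e : G.E // G.lo e = v}

/-- Number of edges at `v` that go down from `v`. -/
noncomputable def downDegree (v : G.V) : ℕ := Nat.card {e : G.E // G.hi e = v}

def IsLocalMin (v : G.V) : Prop := G.downDegree v = 0 ∧ G.upDegree v = 1
def IsUpFork (v : G.V) : Prop := G.downDegree v = 1 ∧ G.upDegree v = 2
def IsDownFork (v : G.V) : Prop := G.downDegree v = 2 ∧ G.upDegree v = 1
def IsLocalMax (v : G.V) : Prop := G.downDegree v = 1 ∧ G.upDegree v = 0

/-- Every vertex is of one of the four types that occur for Morse functions. -/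
def IsMorseGeneric : Prop :=
  ∀ v, G.IsLocalMin v ∨ G.IsUpFork v ∨ G.IsDownFork v ∨ G.IsLocalMax v

/-- No two vertices have the same height. -/
def IsFunctionGeneric : Prop := Function.Injective G.f

def IsGeneric : Prop := G.IsFunctionGeneric ∧ G.IsMorseGeneric

/-! ### The topological space of a Reeb graph -/

/-- The disjoint pieces: one point for each vertex `v`, and for each edge `e` the closed interval
`[f (lo e), f (hi e)]`. -/
def Pieces : Type u := G.V ⊕ (Σ e : G.E, Set.Icc (G.f (G.lo e)) (G.f (G.hi e)))

/-- The vertices are discrete; sum and sigma types carry the disjoint union topology. -/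
instance : TopologicalSpace G.Pieces :=
  letI : TopologicalSpace G.V := ⊥
  letI : TopologicalSpace G.E := ⊥
  inferInstanceAs (TopologicalSpace (G.V ⊕ (Σ e : G.E, Set.Icc (G.f (G.lo e)) (G.f (G.hi e)))))

/-- The gluing: the two ends of the interval of `e` are attached to `lo e` and `hi e`. -/
inductive Glue : G.Pieces → G.Pieces → Prop
  | lower (e : G.E) :
      Glue (Sum.inr ⟨e, ⟨G.f (G.lo e), Set.left_mem_Icc.2 (G.lo_lt_hi e).le⟩⟩) (Sum.inl (G.lo e))
  | upper (e : G.E) :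
      Glue (Sum.inr ⟨e, ⟨G.f (G.hi e), Set.right_mem_Icc.2 (G.lo_lt_hi e).le⟩⟩) (Sum.inl (G.hi e))

/-- The underlying space of the Reeb graph: the quotient of the pieces by the equivalence relation
generated by the gluing, with the quotient topology. -/
def Space : Type u := Quot G.Glue

instance : TopologicalSpace G.Space := inferInstanceAs (TopologicalSpace (Quot G.Glue))

/-- The height of a point of a piece: projection to the real coordinate. -/
def pieceHeight : G.Pieces → ℝ :=
  Sum.elim G.f (fun p => (p.2 : ℝ))

/-- The height function on the Reeb graph. -/
def height : G.Space → ℝ :=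
  Quot.lift G.pieceHeight (by rintro _ _ (e | e) <;> rfl)

theorem continuous_height : Continuous G.height := by
  let : TopologicalSpace G.V := ⊥
  let : TopologicalSpace G.E := ⊥
  have : DiscreteTopology G.V := ⟨rfl⟩
  refine continuous_quot_lift _ ?_
  exact Continuous.sumElim continuous_of_discreteTopology
    (continuous_sigma fun e => continuous_subtype_val)

/-- A vertex, as a point of the space. -/
def vertexPt (v : G.V) : G.Space := Quot.mk _ (Sum.inl v)

/-! ### First homology of pairs of subgraphs, and the diagram `Ext₁` -/

section Homology

variable (k : Type w) [Field k]

/-- The functions `ι → k` that vanish outside `I`. -/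
def supportedOn {ι : Type u} (I : Set ι) : Submodule k (ι → k) where
  carrier := {c | ∀ i, i ∉ I → c i = 0}
  add_mem' := fun {a b} ha hb i hi => by simp [ha i hi, hb i hi]
  zero_mem' := fun _ _ => rfl
  smul_mem' := fun r a ha i hi => by simp [ha i hi]

theorem supportedOn_mono {ι : Type u} {I J : Set ι} (h : I ⊆ J) :
    supportedOn k I ≤ supportedOn k J :=
  fun _ hc i hi => hc i (fun hI => hi (h hI))

open Classical in
/-- The cellular boundary `C₁ = (E → k) → C₀ = (V → k)` of the graph, which sends (the indicator of)
the edge `e` to `hi e - lo e`. -/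
noncomputable def boundary : (G.E → k) →ₗ[k] (G.V → k) :=
  Fintype.linearCombination k
    (fun e : G.E => (Pi.single (G.hi e) (1 : k) - Pi.single (G.lo e) (1 : k) : G.V → k))

/-- The cellular 1-chains of the full subgraph on a set `P` of vertices. -/
def chains (P : Set G.V) : Submodule k (G.E → k) :=
  supportedOn k {e | G.lo e ∈ P ∧ G.hi e ∈ P}

/-- The relative 1-cycles of the pair of full subgraphs on `A ⊆ P`: the 1-chains of `P` whose
boundary is a 0-chain of `A`. -/
noncomputable def relCycles (P A : Set G.V) : Submodule k (G.E → k) :=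
  G.chains k P ⊓ (supportedOn k A).comap (G.boundary k)

/-- The relative homology `H₁(P, A)` of a pair of full subgraphs. As there are no 2-cells, it is
the quotient of the relative 1-cycles by the 1-chains of `A`. For `A = ∅` this is `H₁(P)`. -/
abbrev relH1 (P A : Set G.V) : Type (max u w) :=
  (G.relCycles k P A) ⧸ ((G.chains k A).comap (G.relCycles k P A).subtype)

theorem chains_mono {P P' : Set G.V} (h : P ⊆ P') : G.chains k P ≤ G.chains k P' :=
  supportedOn_mono k (fun _ he => ⟨h he.1, h he.2⟩)

theorem relCycles_mono {P P' A A' : Set G.V} (hP : P ⊆ P') (hA : A ⊆ A') :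
    G.relCycles k P A ≤ G.relCycles k P' A' :=
  inf_le_inf (G.chains_mono k hP) (Submodule.comap_mono (supportedOn_mono k hA))

/-- The map `H₁(P, A) → H₁(P', A')` induced by inclusion. -/
noncomputable def relH1Map {P P' A A' : Set G.V} (hP : P ⊆ P') (hA : A ⊆ A') :
    G.relH1 k P A →ₗ[k] G.relH1 k P' A' :=
  Submodule.mapQ _ _ (Submodule.inclusion (G.relCycles_mono k hP hA))
    (fun _ hx => G.chains_mono k hA hx)

/-- The rank of the map `H₁(P) → H₁(X, A)` induced by inclusion, where `X` is the whole graph. -/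
noncomputable def extRank (P A : Set G.V) : ℕ :=
  Module.finrank k
    (LinearMap.range (G.relH1Map k (P := P) (P' := Set.univ) (A := ∅) (A' := A)
      (Set.subset_univ P) (Set.empty_subset A)))

/-- The multiplicity of the point `(f v, f u)` in `Ext₁`: the number of intervals in the
extended persistence module
`0 → H₁(X_{a₁}) → ⋯ → H₁(X_{aₙ}) = H₁(X, ∅) → H₁(X, X^{aₙ}) → ⋯ → H₁(X, X^{a₁}) = 0`
that are born at `H₁(X_a)`, with `a = f v`, and die entering `H₁(X, X^b)`, with `b = f u`.
As usual it is expressed by the ranks of the maps between the terms at the two ends of the interval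
and their predecessors.

The closed sublevel set `X_a` deformation retracts to the full subgraph on the vertices of height
at most `a`, and the closed superlevel set `X^b` to the full subgraph on the vertices of height at
least `b`. Hence the predecessor of `H₁(X_a)` is given by the vertices of height less than `a`
(none, and so the zero module, if `a` is the smallest critical value), and that of `H₁(X, X^b)` by
the vertices of height greater than `b` (none if `b` is the largest critical value, which gives
`H₁(X, ∅) = H₁(X)`). -/
noncomputable def ext1Multiplicity (v u : G.V) : ℤ :=
  (G.extRank k {x | G.f x ≤ G.f v} {x | G.f u < G.f x} : ℤ)
    - G.extRank k {x | G.f x < G.f v} {x | G.f u < G.f x}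
    - G.extRank k {x | G.f x ≤ G.f v} {x | G.f u ≤ G.f x}
    + G.extRank k {x | G.f x < G.f v} {x | G.f u ≤ G.f x}

/-- The vertices that contribute to a point `(f v, f u)` of `Ext₁` whose lifetime `|f v - f u|` is
at most `2ε` (in a function-generic graph a vertex is determined by its height). -/
def shortLoopVertices (ε : ℝ) : Set G.V :=
  {w | ∃ v u : G.V, 0 < G.ext1Multiplicity k v u ∧ |G.f v - G.f u| ≤ 2 * ε ∧ (w = v ∨ w = u)}

end Homology

end ReebGraph

/-! ### Reeb quotient and smoothing -/

/-- Two points of an `ℝ`-space `(X, f)` are equivalent if they have the same value and lie in the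
same path component of the level set. -/
def reebSetoid {X : Type u} [TopologicalSpace X] (f : X → ℝ) : Setoid X where
  r x y := f x = f y ∧ JoinedIn (f ⁻¹' {f x}) x y
  iseqv :=
    { refl := fun _ => ⟨rfl, JoinedIn.refl rfl⟩
      symm := fun {_ _} h => ⟨h.1.symm, h.1 ▸ h.2.symm⟩
      trans := fun {_ _ _} h h' => ⟨h.1.trans h'.1, h.2.trans (h.1.symm ▸ h'.2)⟩ }

/-- The Reeb quotient of an `ℝ`-space, with the quotient topology. -/
def ReebQuotient {X : Type u} [TopologicalSpace X] (f : X → ℝ) : Type u := Quotient (reebSetoid f)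

namespace ReebQuotient

variable {X : Type u} [TopologicalSpace X] (f : X → ℝ)

instance : TopologicalSpace (ReebQuotient f) :=
  inferInstanceAs (TopologicalSpace (Quotient (reebSetoid f)))

/-- The quotient map. -/
def mk (x : X) : ReebQuotient f := Quotient.mk (reebSetoid f) x

/-- The induced function on the Reeb quotient. -/
def height : ReebQuotient f → ℝ := Quotient.lift f (fun _ _ h => h.1)

end ReebQuotient

/-- The function `f + Id` on the thickening `X × [-ε, ε]`. -/
def thickenedHeight {X : Type u} (f : X → ℝ) (ε : ℝ) : X × Set.Icc (-ε) ε → ℝ :=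
  fun p => f p.1 + (p.2 : ℝ)

/-- The `ε`-smoothing of an `ℝ`-space: the Reeb quotient of its thickening. -/
abbrev Smoothing {X : Type u} [TopologicalSpace X] (f : X → ℝ) (ε : ℝ) : Type u :=
  ReebQuotient (thickenedHeight f ε)

/-- The function on the `ε`-smoothing. -/
abbrev smoothingHeight {X : Type u} [TopologicalSpace X] (f : X → ℝ) (ε : ℝ) :
    Smoothing f ε → ℝ :=
  ReebQuotient.height (thickenedHeight f ε)

/-- The class in the `ε`-smoothing of the point `(x, t)` of the thickening. -/
abbrev smoothingMk {X : Type u} [TopologicalSpace X] (f : X → ℝ) (ε : ℝ)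
    (x : X) (t : Set.Icc (-ε) ε) : Smoothing f ε :=
  ReebQuotient.mk (thickenedHeight f ε) (x, t)

/-! Each edge `e` of `X` traces out an arc in the smoothing: at height `c` between `f (lo e) - ε`
and `f (hi e) + ε`, the points `(x, c - f x)` with `x` on `e` form a segment, hence a single class
(`smoothingMk_edgePt`). These arcs cover the smoothing, because every vertex has an edge. Everything
rests on knowing when two of them meet: at height `c` the arcs of `e` and `e'` agree exactly if `e`
and `e'` are connected through vertices of height in `[c - ε, c + ε]` (`smoothArc_eq_iff`). The
topology of level sets thereby becomes combinatorics of edges.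

The window `[c - ε, c + ε]` gains or loses a vertex only at the heights `f v ± ε`. Cutting the
smoothing at these levels gives an elementary Reeb graph (`isArcCover_smoothing`,
`IsArcCover.isArcModel`), and merging the edges at its vertices of degree `(1,1)` gives the graph
wanted (`IsArcModel.exists_remove_regular`). The parametrization by arcs is a continuous bijection
from a compact space, and the smoothing is Hausdorff (`t2Space_smoothing`), so it is a
homeomorphism.

It remains to compute degrees. Just below `f v - ε` the vertex `v` has left the window and no other
has. So only the class of `(v, -ε)` can split, into the arcs of the down-edges of `v`, up to
connections through heights in `[f v - 2ε, f v)`. Just above `f v - ε` nothing has left the window,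
since `2ε` is not a difference of critical values; the up-degree is therefore one. Hence the point
is irregular only for a local minimum, or for a down-fork whose two down-edges are not so connected,
and then it has the degrees of `v` (`degree_at_lower_level`). The heights `f v + ε` are dual.

Finally, the connected forks are those in `W`. There are no 2-cells, so the multiplicity of `(f v, f
u)` in `Ext₁` is the dimension of the cycles over `[f u, f v]` modulo sums of cycles over `[f u, f
v)` and over `(f u, f v]`. A nonzero class must pass through `v` on two edges, and conversely the
highest possible bottom of a cycle through such edges is a partner of `v` (`exists_hasPairing_iff`,
`mem_shortLoopVertices_iff`). -/

namespace ReebGraph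

open Set

/-! ### Points on edges -/

section EdgePoints

variable (G : ReebGraph.{u})

/-- The point of the edge `e` at height `s`, where `s` is first projected to the range of heights
of `e`. -/
noncomputable def edgePt (e : G.E) (s : ℝ) : G.Space :=
  Quot.mk _ (Sum.inr ⟨e, projIcc _ _ (G.lo_lt_hi e).le s⟩)

theorem continuous_pieces_dom {Z : Type*} [TopologicalSpace Z] {F : G.Pieces → Z}
    (h : ∀ e, Continuous fun s : Icc (G.f (G.lo e)) (G.f (G.hi e)) => F (Sum.inr ⟨e, s⟩)) :
    Continuous F := by
  let : TopologicalSpace G.V := ⊥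
  let : TopologicalSpace G.E := ⊥
  have : DiscreteTopology G.V := ⟨rfl⟩
  have hF : F = Sum.elim (fun v => F (Sum.inl v)) (fun p => F (Sum.inr p)) := by
    funext x
    cases x <;> rfl
  rw [hF]
  exact Continuous.sumElim continuous_of_discreteTopology (continuous_sigma fun e => h e)

theorem continuous_inr_mk (e : G.E) :
    Continuous fun s : Icc (G.f (G.lo e)) (G.f (G.hi e)) =>
      (show G.Pieces from Sum.inr ⟨e, s⟩) := by
  let : TopologicalSpace G.V := ⊥
  let : TopologicalSpace G.E := ⊥
  exact continuous_inr.comp (continuous_sigmaMk (ι := G.E)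
    (σ := fun e : G.E => Icc (G.f (G.lo e)) (G.f (G.hi e))))

theorem continuous_quotMk : Continuous (Quot.mk G.Glue : G.Pieces → G.Space) :=
  continuous_quot_mk

theorem continuous_edgePt (e : G.E) : Continuous (G.edgePt e) :=
  G.continuous_quotMk.comp ((G.continuous_inr_mk e).comp continuous_projIcc)

instance : CompactSpace G.Pieces := by
  let : TopologicalSpace G.V := ⊥
  let : TopologicalSpace G.E := ⊥
  exact inferInstanceAs
    (CompactSpace (G.V ⊕ (Σ e : G.E, Icc (G.f (G.lo e)) (G.f (G.hi e)))))

instance : CompactSpace G.Space := inferInstanceAs (CompactSpace (Quot G.Glue))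

theorem edgePt_lo (e : G.E) : G.edgePt e (G.f (G.lo e)) = G.vertexPt (G.lo e) := by
  rw [edgePt, projIcc_left]
  exact Quot.sound (Glue.lower e)

theorem edgePt_hi (e : G.E) : G.edgePt e (G.f (G.hi e)) = G.vertexPt (G.hi e) := by
  rw [edgePt, projIcc_right]
  exact Quot.sound (Glue.upper e)

theorem height_vertexPt (v : G.V) : G.height (G.vertexPt v) = G.f v := rfl

theorem height_edgePt (e : G.E) (s : ℝ) :
    G.height (G.edgePt e s) = projIcc _ _ (G.lo_lt_hi e).le s := rfl

theorem height_edgePt_of_mem {e : G.E} {s : ℝ} (hs : s ∈ Icc (G.f (G.lo e)) (G.f (G.hi e))) :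
    G.height (G.edgePt e s) = s := by
  rw [height_edgePt, projIcc_of_mem _ hs]

theorem edgePt_val (e : G.E) (s : Icc (G.f (G.lo e)) (G.f (G.hi e))) :
    G.edgePt e s = Quot.mk _ (Sum.inr ⟨e, s⟩) := by
  simp only [edgePt, projIcc_val]
  rfl

theorem space_cases (x : G.Space) :
    (∃ v, x = G.vertexPt v) ∨
      ∃ e, ∃ s ∈ Ioo (G.f (G.lo e)) (G.f (G.hi e)), x = G.edgePt e s := by
  induction x using Quot.ind with
  | mk x =>
    rcases x with v | ⟨e, s⟩
    · exact Or.inl ⟨v, rfl⟩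
    · have hx := G.edgePt_val e s
      rcases s.2.1.eq_or_lt with h | h
      · exact Or.inl ⟨_, hx.symm.trans (by rw [← h, edgePt_lo])⟩
      rcases s.2.2.eq_or_lt with h' | h'
      · exact Or.inl ⟨_, hx.symm.trans (by rw [h', edgePt_hi])⟩
      · exact Or.inr ⟨e, s, ⟨h, h'⟩, hx.symm⟩

/-- An interior point of an edge lies on no other edge. -/
theorem eq_of_edgePt_eq {e e' : G.E} {s s' : ℝ} (hs : s ∈ Ioo (G.f (G.lo e)) (G.f (G.hi e)))
    (h : G.edgePt e s = G.edgePt e' s') : e' = e := by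
  -- The predicate "interior point of `e`" is false at both sides of every gluing, so it descends to
  -- the quotient and detects `e`.
  let P : G.Space → Prop := Quot.lift
    (Sum.elim (fun _ => False)
      fun p => p.1 = e ∧ (p.2 : ℝ) ∈ Ioo (G.f (G.lo e)) (G.f (G.hi e))) (by
      rintro _ _ (d | d)
      · refine eq_false ?_
        rintro ⟨rfl, h⟩
        exact h.1.ne rfl
      · refine eq_false ?_
        rintro ⟨rfl, h⟩
        exact h.2.ne rfl)
  have h1 : P (G.edgePt e s) := by
    refine ⟨rfl, ?_⟩
    simpa [projIcc_of_mem _ (Ioo_subset_Icc_self hs)] using hs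
  rw [h] at h1
  exact h1.1

end EdgePoints

/-! ### Spaces that are covered by arcs -/

/-- The maps `p` on the vertices and `γ` on the edges of `H` exhibit `(Y, h)` as a Reeb graph with
combinatorial data `H`: every point of `Y` is in exactly one place. -/
structure IsArcModel (H : ReebGraph.{u}) {Y : Type*} [TopologicalSpace Y] (h : Y → ℝ)
    (p : H.V → Y) (γ : H.E → ℝ → Y) : Prop where
  continuous_arc : ∀ e, Continuous (γ e)
  arc_lo : ∀ e, γ e (H.f (H.lo e)) = p (H.lo e)
  arc_hi : ∀ e, γ e (H.f (H.hi e)) = p (H.hi e)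
  height_vertex : ∀ v, h (p v) = H.f v
  height_arc : ∀ e, ∀ t ∈ Icc (H.f (H.lo e)) (H.f (H.hi e)), h (γ e t) = t
  vertex_injective : Function.Injective p
  arc_ne_vertex : ∀ e, ∀ t ∈ Ioo (H.f (H.lo e)) (H.f (H.hi e)), ∀ v, γ e t ≠ p v
  arc_injective : ∀ e e' t, t ∈ Ioo (H.f (H.lo e)) (H.f (H.hi e)) →
    t ∈ Ioo (H.f (H.lo e')) (H.f (H.hi e')) → γ e t = γ e' t → e = e'
  exists_eq : ∀ y, (∃ v, p v = y) ∨
    ∃ e, h y ∈ Ioo (H.f (H.lo e)) (H.f (H.hi e)) ∧ γ e (h y) = y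

namespace IsArcModel

variable {H : ReebGraph.{u}} {Y : Type*} [TopologicalSpace Y] {h : Y → ℝ} {p : H.V → Y}
  {γ : H.E → ℝ → Y}

/-- The map from the space of `H` that is given by the arcs. -/
def toFun (hm : H.IsArcModel h p γ) : H.Space → Y :=
  Quot.lift (Sum.elim p fun x => γ x.1 x.2) (by
    rintro _ _ (e | e)
    · exact hm.arc_lo e
    · exact hm.arc_hi e)

theorem toFun_edgePt (hm : H.IsArcModel h p γ) {e : H.E} {s : ℝ}
    (hs : s ∈ Icc (H.f (H.lo e)) (H.f (H.hi e))) : hm.toFun (H.edgePt e s) = γ e s := by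
  change γ e (projIcc _ _ (H.lo_lt_hi e).le s : Icc _ _) = _
  rw [projIcc_of_mem _ hs]

theorem continuous_toFun (hm : H.IsArcModel h p γ) : Continuous hm.toFun :=
  continuous_quot_lift _ (H.continuous_pieces_dom fun e =>
    (hm.continuous_arc e).comp continuous_subtype_val)

theorem height_toFun (hm : H.IsArcModel h p γ) (x : H.Space) : h (hm.toFun x) = H.height x := by
  rcases H.space_cases x with ⟨v, rfl⟩ | ⟨e, s, hs, rfl⟩
  · exact hm.height_vertex v
  · rw [hm.toFun_edgePt (Ioo_subset_Icc_self hs), H.height_edgePt_of_mem (Ioo_subset_Icc_self hs)]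
    exact hm.height_arc e s (Ioo_subset_Icc_self hs)

/-- Heights are preserved, so two points with the same image have the same height parameter; this is
why the model has to separate arcs only at equal heights. -/
theorem bijective_toFun (hm : H.IsArcModel h p γ) : Function.Bijective hm.toFun := by
  constructor
  · intro x y hxy
    have hh : H.height x = H.height y := by rw [← hm.height_toFun, hxy, hm.height_toFun]
    rcases H.space_cases x with ⟨v, rfl⟩ | ⟨e, s, hs, rfl⟩ <;>
      rcases H.space_cases y with ⟨v', rfl⟩ | ⟨e', s', hs', rfl⟩
    · rw [hm.vertex_injective hxy]
    · rw [hm.toFun_edgePt (Ioo_subset_Icc_self hs')] at hxy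
      exact absurd hxy.symm (hm.arc_ne_vertex _ _ hs' _)
    · rw [hm.toFun_edgePt (Ioo_subset_Icc_self hs)] at hxy
      exact absurd hxy (hm.arc_ne_vertex _ _ hs _)
    · rw [H.height_edgePt_of_mem (Ioo_subset_Icc_self hs),
        H.height_edgePt_of_mem (Ioo_subset_Icc_self hs')] at hh
      subst hh
      rw [hm.toFun_edgePt (Ioo_subset_Icc_self hs),
        hm.toFun_edgePt (Ioo_subset_Icc_self hs')] at hxy
      rw [hm.arc_injective _ _ _ hs hs' hxy]
  · intro y
    rcases hm.exists_eq y with ⟨v, hv⟩ | ⟨e, he, hy⟩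
    · exact ⟨H.vertexPt v, hv⟩
    · exact ⟨H.edgePt e (h y), by rw [hm.toFun_edgePt (Ioo_subset_Icc_self he), hy]⟩

/-- A Hausdorff space that is covered by arcs is homeomorphic to the Reeb graph. -/
noncomputable def homeomorph [T2Space Y] (hm : H.IsArcModel h p γ) : H.Space ≃ₜ Y :=
  Continuous.homeoOfEquivCompactToT2 (f := Equiv.ofBijective _ hm.bijective_toFun)
    hm.continuous_toFun

end IsArcModel

end ReebGraph

namespace ReebGraph

open Set

/-! ### Removing regular vertices -/

section Merge

variable (H : ReebGraph.{u}) {v : H.V} {d e : H.E}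

open Classical in
/-- The graph obtained by merging the only down-edge `d` and the only up-edge `e` of `v`. -/
noncomputable def merge (hd : ∀ x, H.hi x = v ↔ x = d) (he : ∀ x, H.lo x = v ↔ x = e) :
    ReebGraph.{u} where
  V := {w : H.V // w ≠ v}
  -- The merged edge keeps the name `d`, and only its upper end changes.
  E := {x : H.E // x ≠ e}
  fintypeV := Fintype.ofFinite _
  fintypeE := Fintype.ofFinite _
  f w := H.f w
  lo x := ⟨H.lo x, fun h => x.2 ((he x).1 h)⟩
  hi x := ⟨if x.1 = d then H.hi e else H.hi x, by
    have hev := (he e).2 rfl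
    split_ifs with h
    · intro h'
      have := H.lo_lt_hi e
      rw [hev, h'] at this
      exact this.false
    · exact fun h' => h ((hd x).1 h')⟩
  lo_lt_hi x := by
    have hdv := (hd d).2 rfl
    have hev := (he e).2 rfl
    dsimp only
    split_ifs with h
    · have h1 := H.lo_lt_hi x
      have h2 := H.lo_lt_hi e
      rw [h, hdv] at h1
      rw [hev] at h2
      rw [h]
      exact h1.trans h2
    · exact H.lo_lt_hi x

variable (hd : ∀ x, H.hi x = v ↔ x = d) (he : ∀ x, H.lo x = v ↔ x = e)

theorem ne_of_merge (hd : ∀ x, H.hi x = v ↔ x = d) (he : ∀ x, H.lo x = v ↔ x = e) : d ≠ e := by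
  rintro rfl
  have := H.lo_lt_hi d
  rw [(hd d).2 rfl, (he d).2 rfl] at this
  exact this.false

theorem exists_merge_edge {x : H.E} (hx : x ≠ e) : ∃ x' : (H.merge hd he).E, x'.1 = x :=
  ⟨⟨x, hx⟩, rfl⟩

theorem merge_hi_of_eq {x : (H.merge hd he).E} (hx : x.1 = d) :
    ((H.merge hd he).hi x).1 = H.hi e := if_pos hx

theorem merge_hi_of_ne {x : (H.merge hd he).E} (hx : x.1 ≠ d) :
    ((H.merge hd he).hi x).1 = H.hi x.1 := if_neg hx

theorem merge_upDegree (w : (H.merge hd he).V) :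
    (H.merge hd he).upDegree w = H.upDegree w.1 := by
  refine Nat.card_congr ⟨fun x => ⟨x.1.1, congrArg Subtype.val x.2⟩,
    fun x => ⟨⟨x.1, fun h => w.2 ?_⟩, Subtype.ext x.2⟩, fun _ => rfl, fun _ => rfl⟩
  rw [← x.2, h, (he e).2 rfl]

/-- At the upper end of the merged edge, `d` takes the place of `e`; the bijection renames it back.
-/
theorem merge_downDegree (w : (H.merge hd he).V) :
    (H.merge hd he).downDegree w = H.downDegree w.1 := by
  classical
  have hde := H.ne_of_merge hd he
  refine Nat.card_eq_of_bijective
    (fun x : {x // (H.merge hd he).hi x = w} =>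
      (⟨if x.1.1 = d then e else x.1.1, ?_⟩ : {x // H.hi x = w.1})) ⟨?_, ?_⟩
  · have hx := congrArg Subtype.val x.2
    split_ifs with h
    · rwa [merge_hi_of_eq H hd he h] at hx
    · rwa [merge_hi_of_ne H hd he h] at hx
  · intro x y hxy
    have hxy := congrArg Subtype.val hxy
    dsimp only at hxy
    refine Subtype.ext (Subtype.ext ?_)
    have hx := x.1.2
    have hy := y.1.2
    split_ifs at hxy with h1 h2 h2
    · rw [h1, h2]
    · exact absurd hxy.symm hy
    · exact absurd hxy hx
    · exact hxy
  · rintro ⟨x, hx⟩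
    by_cases h : x = e
    · obtain ⟨d', hd'⟩ := H.exists_merge_edge hd he hde
      refine ⟨⟨d', Subtype.ext ?_⟩, Subtype.ext ?_⟩
      · rw [merge_hi_of_eq H hd he hd', ← h, hx]
      · simp [h, hd']
    · have hxd : x ≠ d := by
        rintro rfl
        exact w.2 (hx.symm.trans ((hd x).2 rfl))
      obtain ⟨x', rfl⟩ := H.exists_merge_edge hd he h
      refine ⟨⟨x', Subtype.ext ?_⟩, Subtype.ext ?_⟩
      · rw [merge_hi_of_ne H hd he hxd, hx]
      · simp [hxd]

-- The arcs of `d` and `e` agree at the height of `v`, so they glue to a continuous arc. An interior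
-- point of a new arc is then `p v`, an interior point of the arc of `e`, or an interior point of an
-- old arc of the same name, and each clause is inherited from the old model.
open Classical in
theorem IsArcModel.merge {Y : Type*} [TopologicalSpace Y] {h : Y → ℝ} {p : H.V → Y}
    {γ : H.E → ℝ → Y} (hm : H.IsArcModel h p γ) :
    (H.merge hd he).IsArcModel h (fun w => p w.1)
      (fun x t => if x.1 = d then if t ≤ H.f v then γ d t else γ e t else γ x.1 t) := by
  have hdv := (hd d).2 rfl
  have hev := (he e).2 rfl
  have hde := H.ne_of_merge hd he
  have hlo (x : (H.merge hd he).E) : (H.merge hd he).f ((H.merge hd he).lo x) = H.f (H.lo x.1) :=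
    rfl
  have hhi (x : (H.merge hd he).E) (hx : x.1 = d) :
      (H.merge hd he).f ((H.merge hd he).hi x) = H.f (H.hi e) :=
    congrArg H.f (H.merge_hi_of_eq hd he hx)
  have hhi' (x : (H.merge hd he).E) (hx : x.1 ≠ d) :
      (H.merge hd he).f ((H.merge hd he).hi x) = H.f (H.hi x.1) :=
    congrArg H.f (H.merge_hi_of_ne hd he hx)
  have hld : H.f (H.lo d) < H.f v := hdv ▸ H.lo_lt_hi d
  have hve : H.f v < H.f (H.hi e) := hev ▸ H.lo_lt_hi e
  have hγd : γ d (H.f v) = p v := by simpa [hdv] using hm.arc_hi d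
  have hγe : γ e (H.f v) = p v := by simpa [hev] using hm.arc_lo e
  -- a description of the interior points of the new arcs
  have key (x : (H.merge hd he).E) (t : ℝ)
      (ht : t ∈ Ioo ((H.merge hd he).f ((H.merge hd he).lo x))
        ((H.merge hd he).f ((H.merge hd he).hi x))) :
      (x.1 = d ∧ t = H.f v ∧
        (if x.1 = d then if t ≤ H.f v then γ d t else γ e t else γ x.1 t) = p v) ∨
      (x.1 = d ∧ t ∈ Ioo (H.f (H.lo e)) (H.f (H.hi e)) ∧
        (if x.1 = d then if t ≤ H.f v then γ d t else γ e t else γ x.1 t) = γ e t) ∨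
      (t ∈ Ioo (H.f (H.lo x.1)) (H.f (H.hi x.1)) ∧
        (if x.1 = d then if t ≤ H.f v then γ d t else γ e t else γ x.1 t) = γ x.1 t) := by
    rw [hlo] at ht
    by_cases hx : x.1 = d
    · rw [hhi x hx] at ht
      rcases lt_trichotomy t (H.f v) with h1 | h1 | h1
      · refine Or.inr (Or.inr ⟨⟨ht.1, by rw [hx, hdv]; exact h1⟩, ?_⟩)
        rw [if_pos hx, if_pos h1.le, hx]
      · refine Or.inl ⟨hx, h1, ?_⟩
        rw [if_pos hx, if_pos h1.le, h1, hγd]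
      · refine Or.inr (Or.inl ⟨hx, ⟨by rw [hev]; exact h1, ht.2⟩, ?_⟩)
        rw [if_pos hx, if_neg h1.not_ge]
    · rw [hhi' x hx] at ht
      exact Or.inr (Or.inr ⟨ht, if_neg hx⟩)
  refine
    { continuous_arc := fun x => ?_
      arc_lo := fun x => ?_
      arc_hi := fun x => ?_
      height_vertex := fun w => hm.height_vertex w.1
      height_arc := fun x t ht => ?_
      vertex_injective := fun w w' hw => Subtype.ext (hm.vertex_injective hw)
      arc_ne_vertex := fun x t ht w hw => ?_
      arc_injective := fun x x' t ht ht' hxx => ?_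
      exists_eq := fun y => ?_ }
  · by_cases hx : x.1 = d
    · simp only [hx, if_true]
      refine Continuous.if_le (hm.continuous_arc d) (hm.continuous_arc e) continuous_id
        continuous_const ?_
      intro t ht
      have ht : t = H.f v := ht
      rw [ht, hγd, hγe]
    · simpa only [hx, if_false] using hm.continuous_arc x.1
  · rw [hlo]
    by_cases hx : x.1 = d
    · have hx' : H.lo x.1 = H.lo d := congrArg H.lo hx
      rw [if_pos hx, hx', if_pos hld.le]
      exact (hm.arc_lo d).trans (congrArg p hx'.symm)
    · rw [if_neg hx]
      exact hm.arc_lo _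
  · by_cases hx : x.1 = d
    · rw [hhi x hx, if_pos hx, if_neg hve.not_ge]
      exact (hm.arc_hi e).trans (congrArg p (H.merge_hi_of_eq hd he hx).symm)
    · rw [hhi' x hx, if_neg hx]
      exact (hm.arc_hi _).trans (congrArg p (H.merge_hi_of_ne hd he hx).symm)
  · rw [hlo] at ht
    by_cases hx : x.1 = d
    · rw [hhi x hx, hx] at ht
      rw [if_pos hx]
      split_ifs with h1
      · exact hm.height_arc d t ⟨ht.1, by rwa [hdv]⟩
      · exact hm.height_arc e t ⟨by rw [hev]; exact (not_le.1 h1).le, ht.2⟩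
    · rw [hhi' x hx] at ht
      rw [if_neg hx]
      exact hm.height_arc _ t ht
  · rcases key x t ht with ⟨_, _, h3⟩ | ⟨_, h2, h3⟩ | ⟨h2, h3⟩
    · exact w.2 (hm.vertex_injective (hw.symm.trans h3))
    · exact hm.arc_ne_vertex _ _ h2 _ (h3.symm.trans hw)
    · exact hm.arc_ne_vertex _ _ h2 _ (h3.symm.trans hw)
  · apply Subtype.ext
    -- In the first two forms the edge is `d`. A mixed case would put a vertex inside an arc, or
    -- would make `e` an edge of the merged graph.
    rcases key x t ht with ⟨h1, h2, h3⟩ | ⟨h1, h2, h3⟩ | ⟨h2, h3⟩ <;>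
      rcases key x' t ht' with ⟨h1', h2', h3'⟩ | ⟨h1', h2', h3'⟩ | ⟨h2', h3'⟩
    · rw [h1, h1']
    · rw [h1, h1']
    · exact absurd (h3'.symm.trans (hxx.symm.trans h3)) (hm.arc_ne_vertex _ _ h2' _)
    · rw [h1, h1']
    · rw [h1, h1']
    · exact absurd (hm.arc_injective _ _ _ h2 h2' (h3.symm.trans (hxx.trans h3'))).symm x'.2
    · exact absurd (h3.symm.trans (hxx.trans h3')) (hm.arc_ne_vertex _ _ h2 _)
    · exact absurd (hm.arc_injective _ _ _ h2 h2' (h3.symm.trans (hxx.trans h3'))) x.2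
    · exact hm.arc_injective _ _ _ h2 h2' (h3.symm.trans (hxx.trans h3'))
  · obtain ⟨d', hd'⟩ := H.exists_merge_edge hd he hde
    rcases hm.exists_eq y with ⟨w, hw⟩ | ⟨x, hx, hy⟩
    · by_cases hwv : w = v
      · right
        have hhy : h y = H.f v := by rw [← hw, hm.height_vertex, hwv]
        refine ⟨d', ⟨?_, ?_⟩, ?_⟩
        · rw [hlo, hd', hhy]
          exact hld
        · rw [hhi _ hd', hhy]
          exact hve
        · rw [if_pos hd', if_pos hhy.le, hhy, hγd, ← hw, hwv]
      · exact Or.inl ⟨⟨w, hwv⟩, hw⟩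
    · right
      by_cases hxe : x = e
      · rw [hxe, hev] at hx
        refine ⟨d', ⟨?_, ?_⟩, ?_⟩
        · rw [hlo, hd']
          exact hld.trans hx.1
        · rw [hhi _ hd']
          exact hx.2
        · rw [if_pos hd', if_neg hx.1.not_ge, ← hxe, hy]
      · obtain ⟨x', rfl⟩ := H.exists_merge_edge hd he hxe
        by_cases hxd : x'.1 = d
        · rw [hxd, hdv] at hx
          refine ⟨x', ⟨?_, ?_⟩, ?_⟩
          · rw [hlo, hxd]
            exact hx.1
          · rw [hhi _ hxd]
            exact hx.2.trans hve
          · rw [if_pos hxd, if_pos hx.2.le, ← hxd, hy]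
        · refine ⟨x', ⟨hx.1, ?_⟩, ?_⟩
          · rw [hhi' _ hxd]
            exact hx.2
          · rw [if_neg hxd, hy]

end Merge

/-- If a space has an arc model, then it also has one that has no regular vertices. -/
theorem IsArcModel.exists_remove_regular {Y : Type*} [TopologicalSpace Y] {h : Y → ℝ}
    (U D : Y → ℕ) (n : ℕ) (H : ReebGraph.{u}) (p : H.V → Y) (γ : H.E → ℝ → Y)
    (hn : Nat.card H.V = n) (hm : H.IsArcModel h p γ)
    (hdeg : ∀ v, H.upDegree v = U (p v) ∧ H.downDegree v = D (p v)) :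
    ∃ (H' : ReebGraph.{u}) (p' : H'.V → Y) (γ' : H'.E → ℝ → Y), H'.IsArcModel h p' γ' ∧
      (∀ v, H'.upDegree v = U (p' v) ∧ H'.downDegree v = D (p' v)) ∧
      range p' = {y ∈ range p | ¬ (U y = 1 ∧ D y = 1)} := by
  classical
  -- The degrees are prescribed by functions on `Y` rather than on the graph, so the hypothesis
  -- passes unchanged to the merged graph.
  induction n generalizing H with
  | zero =>
    have := Finite.card_eq_zero_iff.1 hn
    refine ⟨H, p, γ, hm, hdeg, ?_⟩
    ext y
    simp only [mem_ofPred_eq, mem_range, IsEmpty.exists_iff, false_and]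
  | succ n ih =>
    by_cases hv : ∃ v, U (p v) = 1 ∧ D (p v) = 1
    · obtain ⟨v, hv⟩ := hv
      rw [← (hdeg v).1, ← (hdeg v).2] at hv
      obtain ⟨⟨e, he⟩, he'⟩ := Nat.card_eq_one_iff_exists.1 hv.1
      obtain ⟨⟨d, hd⟩, hd'⟩ := Nat.card_eq_one_iff_exists.1 hv.2
      have he1 : ∀ x, H.lo x = v ↔ x = e := fun x =>
        ⟨fun hx => congrArg Subtype.val (he' ⟨x, hx⟩), fun hx => hx ▸ he⟩
      have hd1 : ∀ x, H.hi x = v ↔ x = d := fun x =>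
        ⟨fun hx => congrArg Subtype.val (hd' ⟨x, hx⟩), fun hx => hx ▸ hd⟩
      have hcard : Nat.card {w : H.V // w ≠ v} = n := by
        have := Nat.card_congr (Equiv.optionSubtypeNe v)
        rw [Finite.card_option] at this
        exact Nat.succ_injective (this.trans hn)
      have hdeg' (w : (H.merge hd1 he1).V) : (H.merge hd1 he1).upDegree w = U (p w.1) ∧
          (H.merge hd1 he1).downDegree w = D (p w.1) := by
        rw [H.merge_upDegree, H.merge_downDegree]
        exact hdeg w.1
      obtain ⟨H', p', γ', h1, h2, h3⟩ :=
        ih (H.merge hd1 he1) _ _ hcard (hm.merge H hd1 he1) hdeg'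
      refine ⟨H', p', γ', h1, h2, h3.trans ?_⟩
      rw [(hdeg v).1, (hdeg v).2] at hv
      ext y
      constructor
      · rintro ⟨⟨w, rfl⟩, hy⟩
        exact ⟨⟨w.1, rfl⟩, hy⟩
      · rintro ⟨⟨w, rfl⟩, hy⟩
        exact ⟨⟨⟨w, fun hw => hy (hw ▸ hv)⟩, rfl⟩, hy⟩
    · refine ⟨H, p, γ, hm, hdeg, ?_⟩
      ext y
      constructor
      · rintro ⟨w, rfl⟩
        exact ⟨⟨w, rfl⟩, fun hw => hv ⟨w, hw⟩⟩
      · exact fun hy => hy.1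

end ReebGraph

open Set

/-! ### Gaps of a finite set of real numbers -/

/-- `a < b` are consecutive elements of `C`. -/
structure IsGap (C : Set ℝ) (a b : ℝ) : Prop where
  left_mem : a ∈ C
  right_mem : b ∈ C
  lt : a < b
  notMem : ∀ c ∈ C, ¬ (a < c ∧ c < b)

namespace IsGap

variable {C : Set ℝ} {a b a' b' t : ℝ}

theorem le_left (h : IsGap C a b) (ht : t ∈ C) (htb : t < b) : t ≤ a :=
  not_lt.1 fun hat => h.notMem t ht ⟨hat, htb⟩

theorem right_le (h : IsGap C a b) (ht : t ∈ C) (hat : a < t) : b ≤ t :=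
  not_lt.1 fun htb => h.notMem t ht ⟨hat, htb⟩

theorem notMem_of_mem_Ioo (h : IsGap C a b) (ht : t ∈ Ioo a b) : t ∉ C :=
  fun htC => h.notMem t htC ht

theorem eq_of_mem (h : IsGap C a b) (h' : IsGap C a' b') (ht : t ∈ Ioo a b)
    (ht' : t ∈ Ioo a' b') : a = a' ∧ b = b' :=
  ⟨le_antisymm (h'.le_left h.left_mem (ht.1.trans ht'.2))
    (h.le_left h'.left_mem (ht'.1.trans ht.2)),
   le_antisymm (h.right_le h'.right_mem (ht.1.trans ht'.2))
    (h'.right_le h.right_mem (ht'.1.trans ht.2))⟩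

theorem mid_mem (h : IsGap C a b) : (a + b) / 2 ∈ Ioo a b := by
  have := h.lt
  constructor <;> linarith

theorem exists_of_notMem (hC : C.Finite) (ht : t ∉ C) (hl : ∃ c ∈ C, c ≤ t)
    (hr : ∃ c ∈ C, t ≤ c) : ∃ a b, IsGap C a b ∧ t ∈ Ioo a b := by
  obtain ⟨l, hlC, hlt⟩ := hl
  obtain ⟨r, hrC, hrt⟩ := hr
  obtain ⟨a, ⟨haC, hat⟩, ha⟩ := exists_max_image {c ∈ C | c ≤ t} id
    (hC.subset (sep_subset _ _)) ⟨l, hlC, hlt⟩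
  obtain ⟨b, ⟨hbC, hbt⟩, hb⟩ := exists_min_image {c ∈ C | t ≤ c} id
    (hC.subset (sep_subset _ _)) ⟨r, hrC, hrt⟩
  have hat' : a < t := lt_of_le_of_ne hat fun h => ht (h ▸ haC)
  have hbt' : t < b := lt_of_le_of_ne hbt fun h => ht (h ▸ hbC)
  refine ⟨a, b, ⟨haC, hbC, hat'.trans hbt', fun c hc hcc => ?_⟩, hat', hbt'⟩
  rcases le_total c t with h | h
  · exact hcc.1.not_ge (ha c ⟨hc, h⟩)
  · exact hcc.2.not_ge (hb c ⟨hc, h⟩)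

end IsGap

/-! ### Spaces that are covered by overlapping arcs -/

/-- The arcs `p i` over the intervals `[α i, β i]` cover the space `Y`, and away from the finite set
`C` of heights they neither split nor merge. -/
structure IsArcCover {Y : Type u} [TopologicalSpace Y] (h : Y → ℝ) {ι : Type u} (α β : ι → ℝ)
    (p : ι → ℝ → Y) (C : Set ℝ) : Prop where
  continuous_arc : ∀ i, Continuous (p i)
  height_arc : ∀ i, ∀ t ∈ Icc (α i) (β i), h (p i t) = t
  exists_eq : ∀ y, ∃ i, h y ∈ Icc (α i) (β i) ∧ p i (h y) = y
  left_mem : ∀ i, α i ∈ C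
  right_mem : ∀ i, β i ∈ C
  -- The two conditions on `C` say that `t` lies in the closure of the gap that contains `s` (and `t
  -- = s` if `s ∈ C`). Arcs may thus join at the end of a gap, but may not part inside it.
  transfer : ∀ i j s t, s ∈ Icc (α i) (β i) → s ∈ Icc (α j) (β j) → t ∈ Icc (α i) (β i) →
    t ∈ Icc (α j) (β j) → (∀ c ∈ C, s ≤ c → t ≤ c) → (∀ c ∈ C, c ≤ s → c ≤ t) →
    p i s = p j s → p i t = p j t
  finite_index : Finite ι
  finite_levels : C.Finite

namespace IsArcCover

variable {Y : Type u} [TopologicalSpace Y] {h : Y → ℝ} {ι : Type u} {α β : ι → ℝ}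
  {p : ι → ℝ → Y} {C : Set ℝ}

theorem finite_preimage (hc : IsArcCover h α β p C) {S : Set ℝ} (hS : S.Finite) :
    Finite {y // h y ∈ S} := by
  have := hc.finite_index
  refine Set.Finite.to_subtype ((Set.Finite.image2 p (Set.toFinite univ) hS).subset fun y hy => ?_)
  obtain ⟨i, -, hi⟩ := hc.exists_eq y
  exact ⟨i, mem_univ i, h y, hy, hi⟩

/-- The midpoints of the gaps of `C`. -/
def midpoints (C : Set ℝ) : Set ℝ := {t | ∃ a b, IsGap C a b ∧ t = (a + b) / 2}

theorem finite_midpoints (hC : C.Finite) : (midpoints C).Finite := by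
  refine (Set.Finite.image2 (fun a b => (a + b) / 2) hC hC).subset ?_
  rintro t ⟨a, b, hab, rfl⟩
  exact ⟨a, hab.left_mem, b, hab.right_mem, rfl⟩

/-- Arcs begin and end at heights in `C`, so an arc that enters a gap crosses all of it. -/
theorem Icc_of_mem_Ioo (hc : IsArcCover h α β p C) {a b t : ℝ} {i : ι} (hab : IsGap C a b)
    (ht : t ∈ Ioo a b) (hti : t ∈ Icc (α i) (β i)) : α i ≤ a ∧ b ≤ β i :=
  ⟨hab.le_left (hc.left_mem i) (hti.1.trans_lt ht.2),
    hab.right_le (hc.right_mem i) (ht.1.trans_le hti.2)⟩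

theorem exists_edge_data (hc : IsArcCover h α β p C) (y : {y // h y ∈ midpoints C}) :
    ∃ x : ℝ × ℝ × ι, IsGap C x.1 x.2.1 ∧ h y = (x.1 + x.2.1) / 2 ∧ α x.2.2 ≤ x.1 ∧
      x.2.1 ≤ β x.2.2 ∧ p x.2.2 (h y) = y := by
  obtain ⟨a, b, hab, hy⟩ := y.2
  obtain ⟨i, hi, hpi⟩ := hc.exists_eq y
  have := hc.Icc_of_mem_Ioo hab (hy ▸ hab.mid_mem) hi
  exact ⟨(a, b, i), hab, hy, this.1, this.2, hpi⟩

/-- The lower end of the gap of an elementary edge. -/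
noncomputable def bot (hc : IsArcCover h α β p C) (y : {y // h y ∈ midpoints C}) : ℝ :=
  (hc.exists_edge_data y).choose.1

/-- The upper end of the gap of an elementary edge. -/
noncomputable def top (hc : IsArcCover h α β p C) (y : {y // h y ∈ midpoints C}) : ℝ :=
  (hc.exists_edge_data y).choose.2.1

/-- The index of an arc that contains an elementary edge. -/
noncomputable def index (hc : IsArcCover h α β p C) (y : {y // h y ∈ midpoints C}) : ι :=
  (hc.exists_edge_data y).choose.2.2

variable (hc : IsArcCover h α β p C) (y : {y // h y ∈ midpoints C})
include hc

theorem isGap : IsGap C (hc.bot y) (hc.top y) := (hc.exists_edge_data y).choose_spec.1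

theorem height_edge : h y = (hc.bot y + hc.top y) / 2 :=
  (hc.exists_edge_data y).choose_spec.2.1

theorem height_edge_mem : h y ∈ Ioo (hc.bot y) (hc.top y) :=
  hc.height_edge y ▸ (hc.isGap y).mid_mem

theorem left_le_bot : α (hc.index y) ≤ hc.bot y := (hc.exists_edge_data y).choose_spec.2.2.1

theorem top_le_right : hc.top y ≤ β (hc.index y) := (hc.exists_edge_data y).choose_spec.2.2.2.1

theorem arc_index : p (hc.index y) (h y) = y := (hc.exists_edge_data y).choose_spec.2.2.2.2

theorem Icc_subset : Icc (hc.bot y) (hc.top y) ⊆ Icc (α (hc.index y)) (β (hc.index y)) :=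
  Icc_subset_Icc (hc.left_le_bot y) (hc.top_le_right y)

theorem height_bot : h (p (hc.index y) (hc.bot y)) = hc.bot y :=
  hc.height_arc _ _ (hc.Icc_subset y ⟨le_rfl, (hc.isGap y).lt.le⟩)

theorem height_top : h (p (hc.index y) (hc.top y)) = hc.top y :=
  hc.height_arc _ _ (hc.Icc_subset y ⟨(hc.isGap y).lt.le, le_rfl⟩)

omit hc in
/-- The elementary Reeb graph of a cover by arcs: the space is cut at all heights in `C`. -/
noncomputable def graph (hc : IsArcCover h α β p C) : ReebGraph.{u} where
  V := {y // h y ∈ C}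
  -- Over a gap, arcs that meet coincide; so each strand has exactly one point at the middle height,
  -- which serves as its name.
  E := {y // h y ∈ midpoints C}
  fintypeV := have := hc.finite_preimage hc.finite_levels; Fintype.ofFinite _
  fintypeE := have := hc.finite_preimage (finite_midpoints hc.finite_levels); Fintype.ofFinite _
  f y := h y
  lo y := ⟨p (hc.index y) (hc.bot y), by rw [hc.height_bot]; exact (hc.isGap y).left_mem⟩
  hi y := ⟨p (hc.index y) (hc.top y), by rw [hc.height_top]; exact (hc.isGap y).right_mem⟩
  lo_lt_hi y := by
    dsimp only
    rw [hc.height_bot, hc.height_top]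
    exact (hc.isGap y).lt

theorem transfer_gap {i j : ι} {a b s t : ℝ} (hab : IsGap C a b) (hs : s ∈ Ioo a b)
    (ht : t ∈ Icc a b) (hi : s ∈ Icc (α i) (β i)) (hj : s ∈ Icc (α j) (β j))
    (hij : p i s = p j s) : p i t = p j t := by
  obtain ⟨hi1, hi2⟩ := hc.Icc_of_mem_Ioo hab hs hi
  obtain ⟨hj1, hj2⟩ := hc.Icc_of_mem_Ioo hab hs hj
  exact hc.transfer i j s t hi hj ⟨hi1.trans ht.1, ht.2.trans hi2⟩ ⟨hj1.trans ht.1, ht.2.trans hj2⟩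
    (fun c hcC hsc => ht.2.trans (hab.right_le hcC (hs.1.trans_le hsc)))
    (fun c hcC hsc => (hab.le_left hcC (hsc.trans_lt hs.2)).trans ht.1) hij

/-- The elementary edge through a point of an arc. -/
theorem exists_edge {i : ι} {t : ℝ} (ht : t ∈ Icc (α i) (β i)) (htC : t ∉ C) :
    ∃ y : {y // h y ∈ midpoints C}, t ∈ Ioo (hc.bot y) (hc.top y) ∧
      α i ≤ hc.bot y ∧ hc.top y ≤ β i ∧
      ∀ s ∈ Icc (hc.bot y) (hc.top y), p (hc.index y) s = p i s := by
  obtain ⟨a, b, hab, htab⟩ := IsGap.exists_of_notMem hc.finite_levels htC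
    ⟨_, hc.left_mem i, ht.1⟩ ⟨_, hc.right_mem i, ht.2⟩
  obtain ⟨h1, h2⟩ := hc.Icc_of_mem_Ioo hab htab ht
  have hm : (a + b) / 2 ∈ Icc (α i) (β i) :=
    ⟨h1.trans hab.mid_mem.1.le, hab.mid_mem.2.le.trans h2⟩
  have hh : h (p i ((a + b) / 2)) = (a + b) / 2 := hc.height_arc i _ hm
  -- The arc `p i` and the arc chosen for `y` meet at the midpoint by construction, hence agree over
  -- the closed gap.
  let y : {y // h y ∈ midpoints C} := ⟨p i ((a + b) / 2), a, b, hab, hh⟩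
  have hy : h y = (a + b) / 2 := hh
  obtain ⟨hya, hyb⟩ := (hc.isGap y).eq_of_mem hab (hc.height_edge_mem y) (hy ▸ hab.mid_mem)
  have hpy := hc.arc_index y
  rw [hy] at hpy
  refine ⟨y, by rwa [hya, hyb], by rwa [hya], by rwa [hyb], fun s hs => ?_⟩
  rw [hya, hyb] at hs
  refine hc.transfer_gap hab hab.mid_mem hs (hc.Icc_subset y ?_) hm hpy
  rw [hya, hyb]
  exact Ioo_subset_Icc_self hab.mid_mem

/-- A coincidence anywhere in the gap is transferred to the middle height, where the arcs pass
through the edges' names. -/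
theorem edge_eq_of_arc_eq {y y' : {y // h y ∈ midpoints C}} {t : ℝ}
    (ht : t ∈ Ioo (hc.bot y) (hc.top y)) (ht' : t ∈ Ioo (hc.bot y') (hc.top y'))
    (hyy : p (hc.index y) t = p (hc.index y') t) : y = y' := by
  obtain ⟨h1, h2⟩ := (hc.isGap y).eq_of_mem (hc.isGap y') ht ht'
  have hh : h y = h y' := by rw [hc.height_edge, hc.height_edge, h1, h2]
  apply Subtype.ext
  rw [← hc.arc_index y, ← hc.arc_index y', ← hh]
  exact hc.transfer_gap (hc.isGap y) ht (Ioo_subset_Icc_self (hc.height_edge_mem y))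
    (hc.Icc_subset y (Ioo_subset_Icc_self ht)) (hc.Icc_subset y' (Ioo_subset_Icc_self ht')) hyy

theorem isArcModel : hc.graph.IsArcModel h Subtype.val (fun y => p (hc.index y)) := by
  have hlo (y) : hc.graph.f (hc.graph.lo y) = hc.bot y := hc.height_bot y
  have hhi (y) : hc.graph.f (hc.graph.hi y) = hc.top y := hc.height_top y
  refine
    { continuous_arc := fun y => hc.continuous_arc _
      arc_lo := fun y => by rw [hlo]; rfl
      arc_hi := fun y => by rw [hhi]; rfl
      height_vertex := fun v => rfl
      height_arc := fun y t ht => ?_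
      vertex_injective := Subtype.val_injective
      arc_ne_vertex := fun y t ht v hv => ?_
      arc_injective := fun y y' t ht ht' hyy => ?_
      exists_eq := fun y => ?_ }
  · rw [hlo, hhi] at ht
    exact hc.height_arc _ _ (hc.Icc_subset y ht)
  · rw [hlo, hhi] at ht
    refine (hc.isGap y).notMem_of_mem_Ioo ht ?_
    rw [← hc.height_arc _ _ (hc.Icc_subset y (Ioo_subset_Icc_self ht)), hv]
    exact v.2
  · rw [hlo, hhi] at ht ht'
    exact hc.edge_eq_of_arc_eq ht ht' hyy
  · by_cases hy : h y ∈ C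
    · exact Or.inl ⟨⟨y, hy⟩, rfl⟩
    · right
      obtain ⟨i, hi, hpi⟩ := hc.exists_eq y
      obtain ⟨z, hz1, -, -, hz2⟩ := hc.exists_edge hi hy
      refine ⟨z, ?_, ?_⟩
      · exact ⟨(hlo z).trans_lt hz1.1, hz1.2.trans_eq (hhi z).symm⟩
      · rw [hz2 _ (Ioo_subset_Icc_self hz1), hpi]

/-- The number of elementary edges that go up from `v`, counted slightly above `v`. -/
theorem upDegree_graph (v : hc.graph.V) {t : ℝ} (hvt : h v.1 < t)
    (ht : ∀ c ∈ C, h v.1 < c → t < c) :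
    hc.graph.upDegree v =
      Set.ncard {z | ∃ i, α i ≤ h v.1 ∧ t ≤ β i ∧ p i t = z ∧ p i (h v.1) = v.1} := by
  have hbot (y) (hy : hc.graph.lo y = v) : hc.bot y = h v.1 := by
    rw [← hy]; exact (hc.height_bot y).symm
  have htop (y) (hy : hc.graph.lo y = v) : t < hc.top y :=
    ht _ (hc.isGap y).right_mem (hbot y hy ▸ (hc.isGap y).lt)
  refine Nat.card_eq_of_bijective (fun y : {y // hc.graph.lo y = v} =>
    (⟨p (hc.index y.1) t, hc.index y.1, ?_, ?_, rfl, ?_⟩ :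
      {z | ∃ i, α i ≤ h v.1 ∧ t ≤ β i ∧ p i t = z ∧ p i (h v.1) = v.1})) ⟨?_, ?_⟩
  · rw [← hbot y.1 y.2]
    exact hc.left_le_bot _
  · exact (htop y.1 y.2).le.trans (hc.top_le_right _)
  · rw [← hbot y.1 y.2]
    exact congrArg Subtype.val y.2
  · intro y y' hyy
    refine Subtype.ext (hc.edge_eq_of_arc_eq (t := t) ⟨?_, htop _ y.2⟩ ⟨?_, htop _ y'.2⟩
      (congrArg Subtype.val hyy))
    · rwa [hbot _ y.2]
    · rwa [hbot _ y'.2]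
  · rintro ⟨z, i, hi1, hi2, rfl, hi3⟩
    obtain ⟨y, hy1, hy2, hy3, hy4⟩ := hc.exists_edge (i := i) (t := t)
      ⟨hi1.trans hvt.le, hi2⟩ (fun hC => (ht t hC hvt).false)
    have hb : hc.bot y = h v.1 := by
      refine le_antisymm (not_lt.1 fun hlt => ?_) ((hc.isGap y).le_left v.2 (hvt.trans hy1.2))
      exact (ht _ (hc.isGap y).left_mem hlt).not_gt hy1.1
    refine ⟨⟨y, Subtype.ext ?_⟩, Subtype.ext (hy4 t (Ioo_subset_Icc_self hy1))⟩
    change p (hc.index y) (hc.bot y) = v.1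
    rw [hy4 _ ⟨le_rfl, (hc.isGap y).lt.le⟩, hb, hi3]

/-- The number of elementary edges that go down from `v`, counted slightly below `v`. -/
theorem downDegree_graph (v : hc.graph.V) {t : ℝ} (hvt : t < h v.1)
    (ht : ∀ c ∈ C, c < h v.1 → c < t) :
    hc.graph.downDegree v =
      Set.ncard {z | ∃ i, α i ≤ t ∧ h v.1 ≤ β i ∧ p i t = z ∧ p i (h v.1) = v.1} := by
  have htop (y) (hy : hc.graph.hi y = v) : hc.top y = h v.1 := by
    rw [← hy]; exact (hc.height_top y).symm
  have hbot (y) (hy : hc.graph.hi y = v) : hc.bot y < t :=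
    ht _ (hc.isGap y).left_mem (htop y hy ▸ (hc.isGap y).lt)
  refine Nat.card_eq_of_bijective (fun y : {y // hc.graph.hi y = v} =>
    (⟨p (hc.index y.1) t, hc.index y.1, ?_, ?_, rfl, ?_⟩ :
      {z | ∃ i, α i ≤ t ∧ h v.1 ≤ β i ∧ p i t = z ∧ p i (h v.1) = v.1})) ⟨?_, ?_⟩
  · exact (hc.left_le_bot _).trans (hbot y.1 y.2).le
  · rw [← htop y.1 y.2]
    exact hc.top_le_right _
  · rw [← htop y.1 y.2]
    exact congrArg Subtype.val y.2
  · intro y y' hyy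
    refine Subtype.ext (hc.edge_eq_of_arc_eq (t := t) ⟨hbot _ y.2, ?_⟩ ⟨hbot _ y'.2, ?_⟩
      (congrArg Subtype.val hyy))
    · rwa [htop _ y.2]
    · rwa [htop _ y'.2]
  · rintro ⟨z, i, hi1, hi2, rfl, hi3⟩
    obtain ⟨y, hy1, hy2, hy3, hy4⟩ := hc.exists_edge (i := i) (t := t)
      ⟨hi1, hvt.le.trans hi2⟩ (fun hC => (ht t hC hvt).false)
    have hb : hc.top y = h v.1 := by
      refine le_antisymm ((hc.isGap y).right_le v.2 (hy1.1.trans hvt)) (not_lt.1 fun hlt => ?_)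
      exact (ht _ (hc.isGap y).right_mem hlt).not_gt hy1.2
    refine ⟨⟨y, Subtype.ext ?_⟩, Subtype.ext (hy4 t (Ioo_subset_Icc_self hy1))⟩
    change p (hc.index y) (hc.top y) = v.1
    rw [hy4 _ ⟨(hc.isGap y).lt.le, le_rfl⟩, hb, hi3]

end IsArcCover

namespace ReebGraph

open Set Filter Topology

/-! ### Edges that are connected through a set of vertices -/

section EdgeConn

variable (G : ReebGraph.{u})

/-- The vertex `v` is an end of the edge `e`. -/
def Incident (e : G.E) (v : G.V) : Prop := G.lo e = v ∨ G.hi e = v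

/-- Two edges share an end in `P`. -/
def EdgeAdj (P : Set G.V) (e e' : G.E) : Prop := ∃ v ∈ P, G.Incident e v ∧ G.Incident e' v

/-- Two edges are connected through vertices in `P`. -/
def EdgeConn (P : Set G.V) : G.E → G.E → Prop := Relation.ReflTransGen (G.EdgeAdj P)

variable {G} {P Q : Set G.V} {e e' e'' : G.E}

theorem EdgeAdj.symm (h : G.EdgeAdj P e e') : G.EdgeAdj P e' e :=
  let ⟨v, hv, h1, h2⟩ := h
  ⟨v, hv, h2, h1⟩

theorem EdgeConn.refl (P : Set G.V) (e : G.E) : G.EdgeConn P e e := Relation.ReflTransGen.refl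

theorem EdgeAdj.edgeConn (h : G.EdgeAdj P e e') : G.EdgeConn P e e' :=
  Relation.ReflTransGen.single h

theorem EdgeConn.symm (h : G.EdgeConn P e e') : G.EdgeConn P e' e :=
  have : Std.Symm (G.EdgeAdj P) := ⟨fun _ _ => EdgeAdj.symm⟩
  symm_of (Relation.ReflTransGen (G.EdgeAdj P)) h

theorem EdgeConn.trans (h : G.EdgeConn P e e') (h' : G.EdgeConn P e' e'') :
    G.EdgeConn P e e'' :=
  Relation.ReflTransGen.trans h h'

theorem EdgeConn.mono (hPQ : P ⊆ Q) (h : G.EdgeConn P e e') : G.EdgeConn Q e e' :=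
  Relation.ReflTransGen.mono (fun _ _ ⟨v, hv, h⟩ => ⟨v, hPQ hv, h⟩) _ _ h

end EdgeConn

/-! ### Arcs of the smoothing, their coincidences, and the Hausdorff property. -/

section Smoothing

variable (G : ReebGraph.{u})

/-- The vertices of height in `[c - ε, c + ε]`. -/
def window (ε c : ℝ) : Set G.V := {v | |G.f v - c| ≤ ε}

/-- The union of a set of edges, as a subset of the space. -/
def edgeUnion (S : Set G.E) : Set G.Space :=
  {x | ∃ e ∈ S, ∃ s ∈ Icc (G.f (G.lo e)) (G.f (G.hi e)), G.edgePt e s = x}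

variable {G}

theorem edgePt_projIcc (e : G.E) (s : ℝ) :
    G.edgePt e (projIcc _ _ (G.lo_lt_hi e).le s) = G.edgePt e s := by
  simp only [edgePt, projIcc_val]
  rfl

theorem mem_edgeUnion_projIcc {S : Set G.E} {e : G.E} (he : e ∈ S) (s : ℝ) :
    G.edgePt e s ∈ G.edgeUnion S :=
  ⟨e, he, projIcc _ _ (G.lo_lt_hi e).le s, Subtype.coe_prop _, G.edgePt_projIcc e s⟩

/-- A point that is on two different edges is a common end of them. -/
theorem exists_incident_of_edgePt_eq (hf : G.IsFunctionGeneric) {e e' : G.E} {s s' : ℝ}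
    (hs : s ∈ Icc (G.f (G.lo e)) (G.f (G.hi e))) (hs' : s' ∈ Icc (G.f (G.lo e')) (G.f (G.hi e')))
    (h : G.edgePt e s = G.edgePt e' s') (hne : e ≠ e') :
    ∃ v, G.f v = s ∧ G.edgePt e s = G.vertexPt v ∧ G.Incident e v ∧ G.Incident e' v := by
  have key : ∀ (d d' : G.E) (r r' : ℝ), r ∈ Icc (G.f (G.lo d)) (G.f (G.hi d)) →
      G.edgePt d r = G.edgePt d' r' → d ≠ d' →
      ∃ v, G.f v = r ∧ G.edgePt d r = G.vertexPt v ∧ G.Incident d v := by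
    intro d d' r r' hr hd hdd
    rcases hr.1.eq_or_lt with h1 | h1
    · exact ⟨G.lo d, h1, by rw [← h1, G.edgePt_lo], Or.inl rfl⟩
    rcases hr.2.eq_or_lt with h2 | h2
    · exact ⟨G.hi d, h2.symm, by rw [h2, G.edgePt_hi], Or.inr rfl⟩
    · exact absurd (G.eq_of_edgePt_eq ⟨h1, h2⟩ hd).symm hdd
  obtain ⟨v, hv1, hv2, hv3⟩ := key e e' s s' hs h hne
  obtain ⟨v', hv1', hv2', hv3'⟩ := key e' e s' s hs' h.symm hne.symm
  have hss : s = s' := by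
    rw [← G.height_edgePt_of_mem hs, h, G.height_edgePt_of_mem hs']
  have : v' = v := hf (hv1'.trans (hss.symm.trans hv1.symm))
  exact ⟨v, hv1, hv2, hv3, this ▸ hv3'⟩

/-- In the quotient topology closedness is tested on each piece, where the preimage is either the
whole interval or a finite set. -/
theorem isClosed_edgeUnion (S : Set G.E) : IsClosed (G.edgeUnion S) := by
  classical
  suffices h : IsClosed ((Quot.mk G.Glue : G.Pieces → G.Space) ⁻¹' G.edgeUnion S) from
    (isQuotientMap_quot_mk (r := G.Glue)).isClosed_preimage.1 h
  -- a piece of an edge outside `S` meets the union in ends only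
  have hedge (e : G.E) : IsClosed {s : Icc (G.f (G.lo e)) (G.f (G.hi e)) |
      G.edgePt e s ∈ G.edgeUnion S} := by
    by_cases he : e ∈ S
    · convert isClosed_univ
      exact eq_univ_of_forall fun s => mem_edgeUnion_projIcc he _
    · refine Set.Finite.isClosed (Set.Finite.subset
        (s := Subtype.val ⁻¹' {G.f (G.lo e), G.f (G.hi e)})
        ((Set.toFinite _).preimage Subtype.val_injective.injOn) ?_)
      rintro s ⟨e', he', s', -, hs'⟩
      by_contra hcon
      have hcon : (s : ℝ) ≠ G.f (G.lo e) ∧ (s : ℝ) ≠ G.f (G.hi e) := by simpa using hcon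
      have := G.eq_of_edgePt_eq
        ⟨lt_of_le_of_ne s.2.1 hcon.1.symm, lt_of_le_of_ne s.2.2 hcon.2⟩ hs'.symm
      exact he (this ▸ he')
  rw [← isOpen_compl_iff, isOpen_iff_continuous_mem]
  refine G.continuous_pieces_dom fun e => ?_
  have := isOpen_iff_continuous_mem.1 (hedge e).isOpen_compl
  convert this using 2 with s
  simp only [mem_compl_iff, mem_ofPred_eq]
  rw [edgePt_val]
  rfl

variable {ε : ℝ} (hε : 0 < ε)

variable (G) in
/-- The arc in the smoothing that is traced out by an edge of the graph. -/
noncomputable def smoothArc (e : G.E) (c : ℝ) : Smoothing G.height ε :=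
  -- `edgePt` clamps `c` to the heights of `e`. So the shift is zero along the edge itself, and
  -- beyond an end the arc continues by shifting that end.
  smoothingMk G.height ε (G.edgePt e c)
    (projIcc (-ε) ε (neg_le_self hε.le) (c - G.height (G.edgePt e c)))

theorem continuous_smoothingMk {X : Type*} [TopologicalSpace X] (f : X → ℝ) (ε : ℝ) :
    Continuous fun x : X × Icc (-ε) ε => smoothingMk f ε x.1 x.2 :=
  continuous_quot_mk

theorem continuous_smoothArc (e : G.E) : Continuous (G.smoothArc hε e) := by
  refine (continuous_smoothingMk G.height ε).comp (f := fun c => (G.edgePt e c,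
    projIcc (-ε) ε (neg_le_self hε.le) (c - G.height (G.edgePt e c)))) ?_
  have h := G.continuous_edgePt e
  exact h.prodMk
    (continuous_projIcc.comp (continuous_id.sub (G.continuous_height.comp h)))

theorem continuous_smoothingHeight :
    Continuous (smoothingHeight G.height ε) :=
  continuous_quot_lift _ ((G.continuous_height.comp continuous_fst).add
    (continuous_subtype_val.comp continuous_snd))

theorem sub_height_edgePt_mem {e : G.E} {c : ℝ} (hε : 0 < ε)
    (hc : c ∈ Icc (G.f (G.lo e) - ε) (G.f (G.hi e) + ε)) :
    c - G.height (G.edgePt e c) ∈ Icc (-ε) ε := by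
  have := G.lo_lt_hi e
  rw [height_edgePt, coe_projIcc]
  rcases le_total (G.f (G.hi e)) c with h | h
  · rw [min_eq_left h, max_eq_right this.le]
    constructor <;> linarith [hc.1, hc.2]
  · rw [min_eq_right h]
    rcases le_total (G.f (G.lo e)) c with h' | h'
    · rw [max_eq_right h']
      constructor <;> linarith
    · rw [max_eq_left h']
      constructor <;> linarith [hc.1, hc.2]

theorem smoothingHeight_mk (x : G.Space) (t : Icc (-ε) ε) :
    smoothingHeight G.height ε (smoothingMk G.height ε x t) = G.height x + t := rfl

theorem smoothingHeight_smoothArc {e : G.E} {c : ℝ}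
    (hc : c ∈ Icc (G.f (G.lo e) - ε) (G.f (G.hi e) + ε)) :
    smoothingHeight G.height ε (G.smoothArc hε e c) = c := by
  rw [smoothArc, smoothingHeight_mk, projIcc_of_mem _ (sub_height_edgePt_mem hε hc)]
  ring

/-- The level set at `c` in `e × [-ε, ε]` is the segment of the points `(r, c - r)`. It is path
connected, so every point of it represents the same class as the clamped one. -/
theorem smoothingMk_edgePt {e : G.E} {s : ℝ} (hs : s ∈ Icc (G.f (G.lo e)) (G.f (G.hi e)))
    (t : Icc (-ε) ε) {c : ℝ} (hc : c = s + t) :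
    smoothingMk G.height ε (G.edgePt e s) t = G.smoothArc hε e c := by
  set s' : ℝ := G.height (G.edgePt e c) with hs'
  have hs'mem : s' ∈ Icc (G.f (G.lo e)) (G.f (G.hi e)) := by
    rw [hs', height_edgePt]
    exact Subtype.coe_prop _
  have hcmem : c ∈ Icc (G.f (G.lo e) - ε) (G.f (G.hi e) + ε) := by
    constructor <;> linarith [hs.1, hs.2, t.2.1, t.2.2]
  have hcs' : c - s' ∈ Icc (-ε) ε := sub_height_edgePt_mem hε hcmem
  have hcs : c - s ∈ Icc (-ε) ε := by
    rw [hc, add_sub_cancel_left]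
    exact t.2
  let g : ℝ → G.Space × Icc (-ε) ε := fun r =>
    (G.edgePt e r, projIcc (-ε) ε (neg_le_self hε.le) (c - r))
  have hg : Continuous g :=
    (G.continuous_edgePt e).prodMk (continuous_projIcc.comp (continuous_const.sub continuous_id))
  have hgs : g s = (G.edgePt e s, t) := by
    refine Prod.ext rfl ?_
    change projIcc (-ε) ε (neg_le_self hε.le) (c - s) = t
    rw [projIcc_of_mem _ hcs]
    exact Subtype.ext (by simp [hc])
  have hgs' : g s' = (G.edgePt e c, projIcc (-ε) ε (neg_le_self hε.le) (c - s')) := by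
    refine Prod.ext ?_ rfl
    change G.edgePt e s' = G.edgePt e c
    rw [hs', height_edgePt]
    exact edgePt_projIcc e c
  have hlevel : g '' uIcc s s' ⊆ thickenedHeight G.height ε ⁻¹' {c} := by
    rintro _ ⟨r, hr, rfl⟩
    have hr1 : r ∈ Icc (G.f (G.lo e)) (G.f (G.hi e)) :=
      (convex_Icc _ _).ordConnected.uIcc_subset hs hs'mem hr
    have hr2 : c - r ∈ Icc (-ε) ε := by
      have : r ∈ Icc (c - ε) (c + ε) := by
        refine (convex_Icc _ _).ordConnected.uIcc_subset ?_ ?_ hr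
        · constructor <;> linarith [hcs.1, hcs.2]
        · constructor <;> linarith [hcs'.1, hcs'.2]
      constructor <;> linarith [this.1, this.2]
    change G.height (G.edgePt e r) + (projIcc (-ε) ε (neg_le_self hε.le) (c - r) : ℝ) = c
    rw [G.height_edgePt_of_mem hr1, projIcc_of_mem _ hr2]
    ring
  have hpath : IsPathConnected (g '' uIcc s s') :=
    ((convex_uIcc s s').isPathConnected nonempty_uIcc).image hg
  have hj := hpath.joinedIn _ (mem_image_of_mem g left_mem_uIcc) _
    (mem_image_of_mem g right_mem_uIcc)
  rw [hgs, hgs'] at hj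
  have hh : thickenedHeight G.height ε (G.edgePt e s, t) = c := by
    rw [← hgs]
    exact hlevel (mem_image_of_mem g left_mem_uIcc)
  have hh' : thickenedHeight G.height ε
      (G.edgePt e c, projIcc (-ε) ε (neg_le_self hε.le) (c - s')) = c := by
    rw [← hgs']
    exact hlevel (mem_image_of_mem g right_mem_uIcc)
  exact Quotient.sound ⟨hh.trans hh'.symm, (hj.mono hlevel).mono (by rw [hh])⟩

theorem smoothingMk_vertexPt {e : G.E} {v : G.V} (hev : G.Incident e v) (t : Icc (-ε) ε) {c : ℝ}
    (hc : c = G.f v + t) :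
    smoothingMk G.height ε (G.vertexPt v) t = G.smoothArc hε e c := by
  have := (G.lo_lt_hi e).le
  rcases hev with rfl | rfl
  · rw [← G.edgePt_lo]
    exact smoothingMk_edgePt hε ⟨le_rfl, this⟩ t hc
  · rw [← G.edgePt_hi]
    exact smoothingMk_edgePt hε ⟨this, le_rfl⟩ t hc

theorem exists_edgePt_eq (hinc : ∀ v, ∃ e, G.Incident e v) (x : G.Space) :
    ∃ e, ∃ s ∈ Icc (G.f (G.lo e)) (G.f (G.hi e)), G.edgePt e s = x := by
  rcases G.space_cases x with ⟨v, rfl⟩ | ⟨e, s, hs, rfl⟩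
  · obtain ⟨e, rfl | rfl⟩ := hinc v
    · exact ⟨e, _, ⟨le_rfl, (G.lo_lt_hi e).le⟩, G.edgePt_lo e⟩
    · exact ⟨e, _, ⟨(G.lo_lt_hi e).le, le_rfl⟩, G.edgePt_hi e⟩
  · exact ⟨e, s, Ioo_subset_Icc_self hs, rfl⟩

theorem exists_smoothArc_eq (hinc : ∀ v, ∃ e, G.Incident e v) (y : Smoothing G.height ε) :
    ∃ e, smoothingHeight G.height ε y ∈ Icc (G.f (G.lo e) - ε) (G.f (G.hi e) + ε) ∧
      G.smoothArc hε e (smoothingHeight G.height ε y) = y := by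
  induction y using Quotient.ind with
  | _ z =>
    obtain ⟨x, t⟩ := z
    obtain ⟨e, s, hs, rfl⟩ := exists_edgePt_eq hinc x
    have hh : smoothingHeight G.height ε (smoothingMk G.height ε (G.edgePt e s) t) = s + t := by
      rw [smoothingHeight_mk, G.height_edgePt_of_mem hs]
    refine ⟨e, ?_, (smoothingMk_edgePt hε hs t hh).symm⟩
    change smoothingHeight G.height ε (smoothingMk G.height ε (G.edgePt e s) t) ∈ _
    rw [hh]
    constructor <;> linarith [hs.1, hs.2, t.2.1, t.2.2]

/-- If adjacent edges share an end `v` in the window, then `(v, c - f v)` is in the thickening and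
represents a point of both arcs. -/
theorem smoothArc_eq_of_edgeConn {e e' : G.E} {c : ℝ} (h : G.EdgeConn (G.window ε c) e e') :
    G.smoothArc hε e c = G.smoothArc hε e' c := by
  induction h with
  | refl => rfl
  | tail _ h ih =>
    obtain ⟨v, hv, h1, h2⟩ := h
    have hv' : c - G.f v ∈ Icc (-ε) ε := by
      have := abs_le.1 (show |G.f v - c| ≤ ε from hv)
      constructor <;> linarith
    have hc : c = G.f v + (⟨c - G.f v, hv'⟩ : Icc (-ε) ε) := by simp
    rw [ih, ← smoothingMk_vertexPt hε h1 _ hc, ← smoothingMk_vertexPt hε h2 _ hc]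

/-- A union of classes of edges and the union of the other classes meet in vertices outside the
window only. -/
theorem notMem_edgeUnion_compl (hf : G.IsFunctionGeneric) {P : Set G.V} {S : Set G.E}
    (hS : ∀ e ∈ S, ∀ e', G.EdgeAdj P e e' → e' ∈ S) {x : G.Space}
    (hx : ∀ v, x = G.vertexPt v → v ∈ P) (hxS : x ∈ G.edgeUnion S) : x ∉ G.edgeUnion Sᶜ := by
  rintro ⟨e', he', s', hs', rfl⟩
  obtain ⟨e, he, s, hs, hss⟩ := hxS
  obtain ⟨v, -, hv, h1, h2⟩ := exists_incident_of_edgePt_eq hf hs hs' hss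
    (fun h => he' (h ▸ he))
  exact he' (hS e he e' ⟨v, hx v (hss.symm.trans hv), h1, h2⟩)

theorem mem_window_of_eq {x : G.Space} {t : Icc (-ε) ε} {c : ℝ}
    (hc : thickenedHeight G.height ε (x, t) = c) (v : G.V) (hv : x = G.vertexPt v) :
    v ∈ G.window ε c := by
  change |G.f v - c| ≤ ε
  have : G.f v + t = c := by
    rw [← G.height_vertexPt, ← hv]
    exact hc
  rw [abs_le]
  constructor <;> linarith [t.2.1, t.2.2]

/-- A path in the level set projects to a connected subset of `X`. This is covered by two closed
sets, the union of the edges in the class of `e` and the union of the others. If `e'` is among the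
others, both sets are met, so the path passes over a common point. That point is a vertex in the
window and would connect edges of different classes. -/
theorem edgeConn_of_smoothArc_eq (hf : G.IsFunctionGeneric) (hinc : ∀ v, ∃ e, G.Incident e v)
    {e e' : G.E} {c : ℝ} (hc : c ∈ Icc (G.f (G.lo e) - ε) (G.f (G.hi e) + ε))
    (h : G.smoothArc hε e c = G.smoothArc hε e' c) : G.EdgeConn (G.window ε c) e e' := by
  have hlev := smoothingHeight_smoothArc hε hc
  obtain ⟨-, hj⟩ := Quotient.exact h
  rw [show thickenedHeight G.height ε _ = c from hlev] at hj
  by_contra hcon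
  set S : Set G.E := {d | G.EdgeConn (G.window ε c) e d} with hSdef
  have hS : ∀ d ∈ S, ∀ d', G.EdgeAdj (G.window ε c) d d' → d' ∈ S :=
    fun d hd d' hdd => EdgeConn.trans hd hdd.edgeConn
  have hpre := (isPreconnected_range hj.somePath.continuous).image Prod.fst
    continuous_fst.continuousOn
  have hcover : Prod.fst '' range hj.somePath ⊆ G.edgeUnion S ∪ G.edgeUnion Sᶜ := by
    intro x _
    obtain ⟨d, s, hs, rfl⟩ := exists_edgePt_eq hinc x
    by_cases hd : d ∈ S
    · exact Or.inl ⟨d, hd, s, hs, rfl⟩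
    · exact Or.inr ⟨d, hd, s, hs, rfl⟩
  obtain ⟨x, ⟨z, ⟨r, rfl⟩, rfl⟩, hx1, hx2⟩ := isPreconnected_closed_iff.1 hpre _ _
    (isClosed_edgeUnion S) (isClosed_edgeUnion Sᶜ) hcover
    ⟨_, ⟨_, ⟨0, hj.somePath.source⟩, rfl⟩, mem_edgeUnion_projIcc (EdgeConn.refl _ _) c⟩
    ⟨_, ⟨_, ⟨1, hj.somePath.target⟩, rfl⟩, mem_edgeUnion_projIcc (S := Sᶜ) hcon c⟩
  exact notMem_edgeUnion_compl hf hS (mem_window_of_eq (hj.somePath_mem r)) hx1 hx2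

theorem smoothArc_eq_iff (hf : G.IsFunctionGeneric) (hinc : ∀ v, ∃ e, G.Incident e v)
    {e e' : G.E} {c : ℝ} (hc : c ∈ Icc (G.f (G.lo e) - ε) (G.f (G.hi e) + ε)) :
    G.smoothArc hε e c = G.smoothArc hε e' c ↔ G.EdgeConn (G.window ε c) e e' :=
  ⟨edgeConn_of_smoothArc_eq hε hf hinc hc, smoothArc_eq_of_edgeConn hε⟩

-- The window is closed and there are finitely many vertices, so those outside it stay outside for
-- nearby heights.
variable (G) in
theorem exists_isOpen_window_subset (ε c : ℝ) :
    ∃ O : Set ℝ, IsOpen O ∧ c ∈ O ∧ ∀ c' ∈ O, G.window ε c' ⊆ G.window ε c := by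
  have h : ∀ᶠ c' in 𝓝 c, ∀ v, v ∈ G.window ε c' → v ∈ G.window ε c := by
    refine eventually_all.2 fun v => ?_
    by_cases hv : v ∈ G.window ε c
    · exact Eventually.of_forall fun _ _ => hv
    · have hv' : ε < |G.f v - c| := not_le.1 hv
      have : ContinuousAt (fun c' => |G.f v - c'|) c := by fun_prop
      filter_upwards [this.eventually (lt_mem_nhds hv')] with c' hc' hcon
      exact absurd hcon (not_le.2 hc')
  obtain ⟨O, hO, hO', hc⟩ := eventually_nhds_iff.1 h
  exact ⟨O, hO', hc, hO⟩

/-- For heights in `O`, connection in the window implies connection in `P`, so `S` is a union of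
classes at all these heights at once. Hence avoiding `S` does not depend on the representative, and
the preimage in the thickening is cut out by two open conditions. -/
theorem isOpen_avoid_edgeUnion (hε : 0 < ε) (hf : G.IsFunctionGeneric)
    (hinc : ∀ v, ∃ e, G.Incident e v)
    {O : Set ℝ} (hO : IsOpen O) {P : Set G.V} (hP : ∀ c ∈ O, G.window ε c ⊆ P) {S : Set G.E}
    (hS : ∀ e ∈ S, ∀ e', G.EdgeConn P e e' → e' ∈ S) :
    IsOpen {y : Smoothing G.height ε | smoothingHeight G.height ε y ∈ O ∧
      ∀ x t, y = smoothingMk G.height ε x t → x ∉ G.edgeUnion S} := by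
  suffices h : IsOpen ((fun z : G.Space × Icc (-ε) ε => smoothingMk G.height ε z.1 z.2) ⁻¹'
      {y : Smoothing G.height ε | smoothingHeight G.height ε y ∈ O ∧
        ∀ x t, y = smoothingMk G.height ε x t → x ∉ G.edgeUnion S}) from
    (isQuotientMap_quot_mk (r := (reebSetoid (thickenedHeight G.height ε)).r)).isOpen_preimage.1 h
  have heq : (fun z : G.Space × Icc (-ε) ε => smoothingMk G.height ε z.1 z.2) ⁻¹'
      {y : Smoothing G.height ε | smoothingHeight G.height ε y ∈ O ∧
        ∀ x t, y = smoothingMk G.height ε x t → x ∉ G.edgeUnion S} =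
      (fun z : G.Space × Icc (-ε) ε =>
          smoothingHeight G.height ε (smoothingMk G.height ε z.1 z.2)) ⁻¹' O ∩
        Prod.fst ⁻¹' (G.edgeUnion S)ᶜ := by
    ext ⟨x, t⟩
    constructor
    · rintro ⟨h1, h2⟩
      exact ⟨h1, h2 x t rfl⟩
    · rintro ⟨h1, h2⟩
      refine ⟨h1, fun x' t' hxx hx' => h2 ?_⟩
      obtain ⟨e, s, hs, rfl⟩ := exists_edgePt_eq hinc x
      obtain ⟨e', he', s', hs', rfl⟩ := hx'
      have hc := congrArg (smoothingHeight G.height ε) hxx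
      simp only [smoothingHeight_mk, G.height_edgePt_of_mem hs, G.height_edgePt_of_mem hs'] at hc
      have h1 : s + t ∈ O := by
        have h1 : smoothingHeight G.height ε (smoothingMk G.height ε (G.edgePt e s) t) ∈ O := h1
        rwa [smoothingHeight_mk, G.height_edgePt_of_mem hs] at h1
      simp only [smoothingMk_edgePt hε hs t rfl, smoothingMk_edgePt hε hs' t' hc] at hxx
      have := edgeConn_of_smoothArc_eq hε hf hinc
        (by constructor <;> linarith [hs.1, hs.2, t.2.1, t.2.2]) hxx
      exact ⟨e, hS e' he' e (this.mono (hP _ h1)).symm, s, hs, rfl⟩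
  rw [heq]
  exact (hO.preimage (continuous_smoothingHeight.comp (continuous_smoothingMk G.height ε))).inter
    ((isClosed_edgeUnion S).isOpen_compl.preimage continuous_fst)

/-- Points of different heights are separated by the height. Points of the same height `c` belong to
different classes of edges for the window at `c`; the points near height `c` that avoid the class
`S`, and those that avoid its complement, form disjoint open sets, because every point of `X` is on
some edge. -/
theorem t2Space_smoothing (hε : 0 < ε) (hf : G.IsFunctionGeneric)
    (hinc : ∀ v, ∃ e, G.Incident e v) : T2Space (Smoothing G.height ε) := by
  refine ⟨fun y y' hyy => ?_⟩
  by_cases hh : smoothingHeight G.height ε y = smoothingHeight G.height ε y'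
  swap
  · exact separated_by_continuous continuous_smoothingHeight hh
  obtain ⟨e, he, hey⟩ := exists_smoothArc_eq hε hinc y
  obtain ⟨e', he', hey'⟩ := exists_smoothArc_eq hε hinc y'
  rw [← hh] at he' hey'
  set c := smoothingHeight G.height ε y with hc
  have hee : ¬ G.EdgeConn (G.window ε c) e e' := fun h =>
    hyy (by rw [← hey, ← hey', smoothArc_eq_of_edgeConn hε h])
  obtain ⟨O, hO, hcO, hOw⟩ := G.exists_isOpen_window_subset ε c
  set S : Set G.E := {d | G.EdgeConn (G.window ε c) e d} with hSdef
  have hS : ∀ d ∈ S, ∀ d', G.EdgeConn (G.window ε c) d d' → d' ∈ S :=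
    fun d hd d' hdd => EdgeConn.trans hd hdd
  have hS' : ∀ d ∈ Sᶜ, ∀ d', G.EdgeConn (G.window ε c) d d' → d' ∈ Sᶜ :=
    fun d hd d' hdd hd' => hd (hS d' hd' d hdd.symm)
  have hmem {d : G.E} {z : Smoothing G.height ε} {T : Set G.E}
      (hT : ∀ d ∈ T, ∀ d', G.EdgeConn (G.window ε c) d d' → d' ∈ T)
      (hd : c ∈ Icc (G.f (G.lo d) - ε) (G.f (G.hi d) + ε)) (hz : G.smoothArc hε d c = z)
      (hdT : d ∉ T) :
      z ∈ {z : Smoothing G.height ε | smoothingHeight G.height ε z ∈ O ∧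
        ∀ x t, z = smoothingMk G.height ε x t → x ∉ G.edgeUnion T} := by
    have hzc : smoothingHeight G.height ε z = c := by
      rw [← hz, smoothingHeight_smoothArc hε hd]
    refine ⟨hzc ▸ hcO, ?_⟩
    rintro x t hx ⟨d', hd', s, hs, rfl⟩
    have hst : c = s + t := by rw [← hzc, hx, smoothingHeight_mk, G.height_edgePt_of_mem hs]
    rw [smoothingMk_edgePt hε hs t hst, ← hz] at hx
    exact hdT (hT d' hd' d (edgeConn_of_smoothArc_eq hε hf hinc hd hx).symm)
  refine ⟨_, _, isOpen_avoid_edgeUnion hε hf hinc hO hOw hS',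
    isOpen_avoid_edgeUnion hε hf hinc hO hOw hS,
    hmem hS' he hey (fun h => h (EdgeConn.refl _ _)), hmem hS he' hey' hee, ?_⟩
  rw [Set.disjoint_left]
  rintro z ⟨-, h1⟩ ⟨-, h2⟩
  induction z using Quotient.ind with
  | _ z =>
    obtain ⟨d, s, hs, hd⟩ := exists_edgePt_eq hinc z.1
    by_cases hdS : d ∈ S
    · exact h2 z.1 z.2 rfl ⟨d, hdS, s, hs, hd⟩
    · exact h1 z.1 z.2 rfl ⟨d, hdS, s, hs, hd⟩

end Smoothing

end ReebGraph

namespace ReebGraph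

open Set

/-! ### `Ext₁` in terms of cycles and of connected edges. -/

section Homology

variable (k : Type w) [Field k] (G : ReebGraph.{u})

/-! ### Cycles of a graph -/

open Classical in
/-- The coefficient of the vertex `v` in the boundary of the edge `e`. -/
noncomputable def boundaryCoeff (e : G.E) (v : G.V) : k :=
  (if G.hi e = v then 1 else 0) - (if G.lo e = v then 1 else 0)

theorem lo_ne_hi (e : G.E) : G.lo e ≠ G.hi e := fun h => (h ▸ G.lo_lt_hi e).false

variable {k G} in
theorem boundaryCoeff_ne_zero {e : G.E} {v : G.V} (h : G.Incident e v) :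
    G.boundaryCoeff k e v ≠ 0 := by
  have := G.lo_ne_hi e
  rcases h with rfl | rfl
  · simp [boundaryCoeff, this.symm]
  · simp [boundaryCoeff, this]

variable {k G} in
theorem boundaryCoeff_eq_zero {e : G.E} {v : G.V} (h : ¬ G.Incident e v) :
    G.boundaryCoeff k e v = 0 := by
  have h1 : G.lo e ≠ v := fun h' => h (Or.inl h')
  have h2 : G.hi e ≠ v := fun h' => h (Or.inr h')
  simp [boundaryCoeff, h1, h2]

theorem boundary_apply (z : G.E → k) (v : G.V) :
    G.boundary k z v = ∑ e, z e * G.boundaryCoeff k e v := by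
  classical
  simp only [boundary, Fintype.linearCombination_apply, Finset.sum_apply, Pi.smul_apply,
    Pi.sub_apply, Pi.single_apply, smul_eq_mul, boundaryCoeff, eq_comm]

theorem sum_boundary (z : G.E → k) : ∑ v, G.boundary k z v = 0 := by
  classical
  simp only [boundary_apply]
  rw [Finset.sum_comm]
  refine Finset.sum_eq_zero fun e _ => ?_
  rw [← Finset.mul_sum]
  simp [boundaryCoeff]

/-- The 1-cycles of the full subgraph on `P`. -/
noncomputable abbrev cycles (P : Set G.V) : Submodule k (G.E → k) := G.relCycles k P ∅

variable {k G}

theorem mem_cycles {P : Set G.V} {z : G.E → k} :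
    z ∈ G.cycles k P ↔
      (∀ e, z e ≠ 0 → ∀ v, G.Incident e v → v ∈ P) ∧ ∀ v, G.boundary k z v = 0 := by
  constructor
  · rintro ⟨h1, h2⟩
    refine ⟨fun e he v hv => ?_, fun v => h2 v (notMem_empty v)⟩
    by_contra hvP
    refine he (h1 e fun h => hvP ?_)
    rcases hv with rfl | rfl
    exacts [h.1, h.2]
  · rintro ⟨h1, h2⟩
    refine ⟨fun e he => ?_, fun v _ => h2 v⟩
    by_contra hz
    exact he ⟨h1 e hz _ (Or.inl rfl), h1 e hz _ (Or.inr rfl)⟩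

theorem cycles_mono {P Q : Set G.V} (h : P ⊆ Q) : G.cycles k P ≤ G.cycles k Q :=
  G.relCycles_mono k h le_rfl

theorem cycles_inf (P Q : Set G.V) : G.cycles k P ⊓ G.cycles k Q = G.cycles k (P ∩ Q) := by
  ext z
  simp only [Submodule.mem_inf, mem_cycles]
  exact ⟨fun h => ⟨fun e he v hv => ⟨h.1.1 e he v hv, h.2.1 e he v hv⟩, h.1.2⟩,
    fun h => ⟨⟨fun e he v hv => (h.1 e he v hv).1, h.2⟩,
      fun e he v hv => (h.1 e he v hv).2, h.2⟩⟩

theorem cycles_inf_chains (P Q : Set G.V) :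
    G.cycles k P ⊓ G.chains k Q = G.cycles k (P ∩ Q) := by
  ext z
  constructor
  · rintro ⟨h1, h2⟩
    replace h1 := mem_cycles.1 h1
    refine mem_cycles.2 ⟨fun e he v hv => ⟨h1.1 e he v hv, ?_⟩, h1.2⟩
    by_contra hvQ
    refine he (h2 e fun h => hvQ ?_)
    rcases hv with rfl | rfl
    exacts [h.1, h.2]
  · intro h
    exact ⟨cycles_mono inter_subset_left h, G.chains_mono k inter_subset_right h.1⟩

/-- A cycle that is nonzero on at most one edge at `v` avoids `v`. -/
theorem mem_cycles_diff {P : Set G.V} {z : G.E → k} (hz : z ∈ G.cycles k P) {v : G.V} {d : G.E}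
    (hd : ∀ e, G.Incident e v → e ≠ d → z e = 0) : z ∈ G.cycles k (P \ {v}) := by
  rw [mem_cycles] at hz ⊢
  refine ⟨fun e he w hw => ⟨hz.1 e he w hw, ?_⟩, hz.2⟩
  rintro rfl
  have hed : e = d := by
    by_contra h
    exact he (hd e hw h)
  subst hed
  have h := hz.2 w
  rw [boundary_apply, Finset.sum_eq_single e] at h
  · exact (mul_ne_zero he (boundaryCoeff_ne_zero hw)) h
  · intro e' _ he'
    by_cases h' : G.Incident e' w
    · rw [hd e' h' he', zero_mul]
    · rw [boundaryCoeff_eq_zero h', mul_zero]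
  · exact fun h => absurd (Finset.mem_univ e) h

/-! ### The multiplicities in terms of cycles -/

/-- Without 2-cells a cycle of `P` vanishes in `H₁(X, A)` exactly if it is a chain of `A`, that is,
a cycle of `P ∩ A`. The rest is rank–nullity. -/
theorem extRank_add_finrank (P A : Set G.V) :
    G.extRank k P A + Module.finrank k (G.cycles k (P ∩ A)) =
      Module.finrank k (G.cycles k P) := by
  let φ : G.cycles k P →ₗ[k] G.relH1 k univ A :=
    (G.relH1Map k (subset_univ P) (empty_subset A)).comp (Submodule.mkQ _)
  have hr : LinearMap.range φ =
      LinearMap.range (G.relH1Map k (subset_univ P) (empty_subset A)) :=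
    LinearMap.range_comp_of_range_eq_top _ (Submodule.range_mkQ _)
  have hk : LinearMap.ker φ = (G.cycles k (P ∩ A)).comap (G.cycles k P).subtype := by
    ext z
    rw [← cycles_inf_chains]
    have : φ z = Submodule.Quotient.mk
        (Submodule.inclusion (G.relCycles_mono k (subset_univ P) (empty_subset A)) z) := rfl
    rw [LinearMap.mem_ker, this, Submodule.Quotient.mk_eq_zero]
    exact ⟨fun h => ⟨z.2, h⟩, fun h => h.2⟩
  have hle : G.cycles k (P ∩ A) ≤ G.cycles k P := cycles_mono inter_subset_left
  have hf := φ.finrank_range_add_finrank_ker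
  rw [hr, hk, (Submodule.comapSubtypeEquivOfLe hle).finrank_eq] at hf
  exact hf

/-- Not every cycle on `[u, v]` is a sum of cycles on `[u, v)` and `(u, v]`, where the intervals
refer to the values of `φ`. -/
def HasPairing (k : Type w) [Field k] (G : ReebGraph.{u}) (φ : G.V → ℝ) (v u : G.V) : Prop :=
  ¬ G.cycles k (φ ⁻¹' Icc (φ u) (φ v)) ≤
    G.cycles k (φ ⁻¹' Ico (φ u) (φ v)) ⊔ G.cycles k (φ ⁻¹' Ioc (φ u) (φ v))

/-- In the alternating sum of ranks the terms for sublevel sets cancel. What remains is `dim Z[u,v]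
- dim Z[u,v) - dim Z(u,v] + dim Z(u,v)`. As `Z(u,v)` is the intersection of the two middle spaces,
this is the codimension of their sum in `Z[u,v]`. -/
theorem ext1Multiplicity_pos_iff (v u : G.V) :
    0 < G.ext1Multiplicity k v u ↔ HasPairing k G G.f v u := by
  have h1 := extRank_add_finrank (k := k) {x | G.f x ≤ G.f v} {x | G.f u < G.f x}
  have h2 := extRank_add_finrank (k := k) {x | G.f x < G.f v} {x | G.f u < G.f x}
  have h3 := extRank_add_finrank (k := k) {x | G.f x ≤ G.f v} {x | G.f u ≤ G.f x}
  have h4 := extRank_add_finrank (k := k) {x | G.f x < G.f v} {x | G.f u ≤ G.f x}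
  have e1 : {x | G.f x ≤ G.f v} ∩ {x | G.f u < G.f x} = G.f ⁻¹' Ioc (G.f u) (G.f v) := by
    ext x; exact and_comm
  have e2 : {x | G.f x < G.f v} ∩ {x | G.f u < G.f x} = G.f ⁻¹' Ioo (G.f u) (G.f v) := by
    ext x; exact and_comm
  have e3 : {x | G.f x ≤ G.f v} ∩ {x | G.f u ≤ G.f x} = G.f ⁻¹' Icc (G.f u) (G.f v) := by
    ext x; exact and_comm
  have e4 : {x | G.f x < G.f v} ∩ {x | G.f u ≤ G.f x} = G.f ⁻¹' Ico (G.f u) (G.f v) := by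
    ext x; exact and_comm
  rw [e1] at h1
  rw [e2] at h2
  rw [e3] at h3
  rw [e4] at h4
  have hinf := cycles_inf (k := k) (G.f ⁻¹' Ico (G.f u) (G.f v)) (G.f ⁻¹' Ioc (G.f u) (G.f v))
  have e5 : G.f ⁻¹' Ico (G.f u) (G.f v) ∩ G.f ⁻¹' Ioc (G.f u) (G.f v) =
      G.f ⁻¹' Ioo (G.f u) (G.f v) := by
    ext x
    exact ⟨fun h => ⟨h.2.1, h.1.2⟩, fun h => ⟨⟨h.1.le, h.2⟩, h.1, h.2.le⟩⟩
  rw [e5] at hinf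
  have hsup := Submodule.finrank_sup_add_finrank_inf_eq
    (G.cycles k (G.f ⁻¹' Ico (G.f u) (G.f v))) (G.cycles k (G.f ⁻¹' Ioc (G.f u) (G.f v)))
  rw [hinf] at hsup
  have hle : G.cycles k (G.f ⁻¹' Ico (G.f u) (G.f v)) ⊔ G.cycles k (G.f ⁻¹' Ioc (G.f u) (G.f v)) ≤
      G.cycles k (G.f ⁻¹' Icc (G.f u) (G.f v)) :=
    sup_le (cycles_mono fun x hx => ⟨hx.1, hx.2.le⟩) (cycles_mono fun x hx => ⟨hx.1.le, hx.2⟩)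
  have hlt : HasPairing k G G.f v u ↔
      Module.finrank k ↥(G.cycles k (G.f ⁻¹' Ico (G.f u) (G.f v)) ⊔
        G.cycles k (G.f ⁻¹' Ioc (G.f u) (G.f v))) <
      Module.finrank k (G.cycles k (G.f ⁻¹' Icc (G.f u) (G.f v))) := by
    constructor
    · exact fun h => Submodule.finrank_lt_finrank_of_lt (lt_of_le_not_ge hle h)
    · exact fun h h' => h.not_ge (Submodule.finrank_mono h')
  rw [hlt, ext1Multiplicity]
  omega

/-- Turning the graph upside down exchanges the two ends of a pair; this reduces up-forks to
down-forks. -/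
theorem hasPairing_neg_iff (φ : G.V → ℝ) (v u : G.V) :
    HasPairing k G (fun x => - φ x) u v ↔ HasPairing k G φ v u := by
  have e1 : (fun x => - φ x) ⁻¹' Icc (- φ v) (- φ u) = φ ⁻¹' Icc (φ u) (φ v) := by
    ext x; simp [and_comm]
  have e2 : (fun x => - φ x) ⁻¹' Ico (- φ v) (- φ u) = φ ⁻¹' Ioc (φ u) (φ v) := by
    ext x; simp [and_comm]
  have e3 : (fun x => - φ x) ⁻¹' Ioc (- φ v) (- φ u) = φ ⁻¹' Ico (φ u) (φ v) := by
    ext x; simp [and_comm]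
  rw [HasPairing, HasPairing, e1, e2, e3, sup_comm]

/-! ### Cycles through a fork -/

theorem exists_boundary_eq [DecidableEq G.V] [DecidableEq G.E] {e : G.E} {a b : G.V}
    (ha : G.Incident e a) (hb : G.Incident e b) (hab : a ≠ b) :
    ∃ s : k, s ≠ 0 ∧ G.boundary k (Pi.single e s) = Pi.single b 1 - Pi.single a 1 := by
  have key (s : k) (x : G.V) : G.boundary k (Pi.single e s) x = s * G.boundaryCoeff k e x := by
    rw [boundary_apply, Finset.sum_eq_single e]
    · rw [Pi.single_eq_same]
    · intro e' _ he'
      rw [Pi.single_eq_of_ne he', zero_mul]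
    · exact fun h => absurd (Finset.mem_univ e) h
  rcases ha with rfl | rfl <;> rcases hb with rfl | rfl
  · exact absurd rfl hab
  · refine ⟨1, one_ne_zero, ?_⟩
    ext x
    simp [key, boundaryCoeff, Pi.single_apply, eq_comm]
  · refine ⟨-1, neg_ne_zero.2 one_ne_zero, ?_⟩
    ext x
    simp [key, boundaryCoeff, Pi.single_apply, eq_comm]
  · exact absurd rfl hab

/-- If two edges at `v` are connected in `P`, then there is a cycle through `v` that uses them. -/
theorem exists_cycle_of_edgeConn {P : Set G.V} {v : G.V} (hv : v ∉ P) {d d' : G.E}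
    (hd : G.Incident d v) (hd' : G.Incident d' v) (hne : d ≠ d') (h : G.EdgeConn P d d') :
    ∃ z ∈ G.cycles k (insert v P), z d ≠ 0 := by
  classical
  -- chains from `v` through `d` to a vertex of `P`
  have key (e : G.E) (he : G.EdgeConn P d e) : ∀ x ∈ P, G.Incident e x →
      ∃ z : G.E → k, (∀ e, z e ≠ 0 → ∀ w, G.Incident e w → w ∈ insert v P) ∧ z d ≠ 0 ∧
        G.boundary k z = Pi.single x 1 - Pi.single v 1 := by
    have hends {e : G.E} {a b : G.V} (ha : G.Incident e a) (hb : G.Incident e b) (hab : a ≠ b)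
        (w : G.V) (hw : G.Incident e w) : w = a ∨ w = b := by
      rcases ha with rfl | rfl <;> rcases hb with rfl | rfl <;> rcases hw with rfl | rfl <;>
        simp_all
    induction he with
    | refl =>
      intro x hx hdx
      have hvx : v ≠ x := fun h => hv (h ▸ hx)
      obtain ⟨s, hs, hb⟩ := exists_boundary_eq (k := k) hd hdx hvx
      refine ⟨Pi.single d s, fun e he w hw => ?_, by simpa using hs, hb⟩
      have hed : e = d := by
        by_contra hed
        exact he (by rw [Pi.single_apply, if_neg hed])
      subst hed
      rcases hends hd hdx hvx w hw with rfl | rfl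
      exacts [mem_insert _ _, mem_insert_of_mem _ hx]
    | @tail e₁ e₂ _ h₂ ih =>
      intro x hx hex
      obtain ⟨y, hy, hy1, hy2⟩ := h₂
      obtain ⟨z, hz1, hz2, hz3⟩ := ih y hy hy1
      by_cases hyx : y = x
      · subst hyx
        exact ⟨z, hz1, hz2, hz3⟩
      · obtain ⟨s, hs, hb⟩ := exists_boundary_eq (k := k) hy2 hex hyx
        have hed : d ≠ e₂ := by
          rintro rfl
          rcases hends hy2 hex hyx v hd with rfl | rfl
          exacts [hv hy, hv hx]
        refine ⟨z + Pi.single e₂ s, fun e he w hw => ?_, ?_, ?_⟩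
        · by_cases hee : e = e₂
          · subst hee
            rcases hends hy2 hex hyx w hw with rfl | rfl
            exacts [mem_insert_of_mem _ hy, mem_insert_of_mem _ hx]
          · rw [Pi.add_apply, Pi.single_eq_of_ne hee, add_zero] at he
            exact hz1 e he w hw
        · rwa [Pi.add_apply, Pi.single_eq_of_ne hed, add_zero]
        · rw [map_add, hz3, hb]
          abel
  -- The last link is a vertex `x` of `P` on `d'`; the chain from `v` to `x` is closed by `d'`.
  rcases Relation.ReflTransGen.cases_tail h with h | ⟨e, he, x, hx, hex, hdx⟩
  · exact absurd h.symm hne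
  · obtain ⟨z, hz1, hz2, hz3⟩ := key e he x hx hex
    have hxv : x ≠ v := fun h => hv (h ▸ hx)
    obtain ⟨s, hs, hb⟩ := exists_boundary_eq (k := k) hdx hd' hxv
    refine ⟨z + Pi.single d' s, mem_cycles.2 ⟨fun e he w hw => ?_, fun w => ?_⟩, ?_⟩
    · by_cases hee : e = d'
      · subst hee
        rcases hdx with rfl | rfl <;> rcases hd' with h' | h' <;> rcases hw with rfl | rfl <;>
          simp_all
      · rw [Pi.add_apply, Pi.single_eq_of_ne hee, add_zero] at he
        exact hz1 e he w hw
    · rw [map_add, hz3, hb]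
      simp
    · rwa [Pi.add_apply, Pi.single_eq_of_ne hne, add_zero]

/-- If a cycle passes through `v` on the edges `d` and `d'` only, then these are connected in the
rest of the graph. -/
theorem edgeConn_of_mem_cycles {P : Set G.V} {v : G.V} {d d' : G.E}
    (hd : G.Incident d v) {z : G.E → k} (hz : z ∈ G.cycles k (insert v P)) (hzd : z d ≠ 0)
    (hdd : ∀ e, G.Incident e v → z e ≠ 0 → e = d ∨ e = d') : G.EdgeConn P d d' := by
  classical
  by_contra hcon
  rw [mem_cycles] at hz
  -- Restricting `z` to the class of `d` keeps the boundary zero away from `v`. If `d'` is in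
  -- another class, the coefficient at `v` comes from `d` alone and is nonzero, although the
  -- coefficients of a boundary sum to zero.
  let z' : G.E → k := fun e => if G.EdgeConn P d e then z e else 0
  have hvert (x : G.V) (hx : x ≠ v) : G.boundary k z' x = 0 := by
    by_cases hxP : x ∈ P
    · by_cases hex : ∃ e, G.Incident e x ∧ G.EdgeConn P d e
      · obtain ⟨e, he, hde⟩ := hex
        rw [← hz.2 x, boundary_apply, boundary_apply]
        refine Finset.sum_congr rfl fun e' _ => ?_
        by_cases he' : G.Incident e' x
        · have : G.EdgeConn P d e' := hde.trans (EdgeAdj.edgeConn ⟨x, hxP, he, he'⟩)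
          simp only [z', if_pos this]
        · rw [boundaryCoeff_eq_zero he', mul_zero, mul_zero]
      · rw [boundary_apply]
        refine Finset.sum_eq_zero fun e' _ => ?_
        by_cases he' : G.Incident e' x
        · have : ¬ G.EdgeConn P d e' := fun h => hex ⟨e', he', h⟩
          simp only [z', if_neg this, zero_mul]
        · rw [boundaryCoeff_eq_zero he', mul_zero]
    · rw [boundary_apply]
      refine Finset.sum_eq_zero fun e' _ => ?_
      by_cases he' : G.Incident e' x
      · have : z e' = 0 := by
          by_contra h
          exact (hz.1 e' h x he').elim hx hxP
        simp only [z', this, ite_self, zero_mul]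
      · rw [boundaryCoeff_eq_zero he', mul_zero]
  have hsum := G.sum_boundary k z'
  rw [Finset.sum_eq_single v (fun x _ hx => hvert x hx)
    (fun h => absurd (Finset.mem_univ v) h), boundary_apply, Finset.sum_eq_single d] at hsum
  · simp only [z', if_pos (EdgeConn.refl P d)] at hsum
    exact mul_ne_zero hzd (boundaryCoeff_ne_zero hd) hsum
  · intro e _ hed
    by_cases he : G.Incident e v
    · by_cases hze : z e = 0
      · simp only [z', hze, ite_self, zero_mul]
      · obtain rfl := (hdd e he hze).resolve_left hed
        simp only [z', if_neg hcon, zero_mul]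
    · rw [boundaryCoeff_eq_zero he, mul_zero]
  · exact fun h => absurd (Finset.mem_univ d) h

/-! ### Vertices of short loops -/

/-- The edges at `v` on which `φ` is at most `φ v`. -/
def edgesBelow (G : ReebGraph.{u}) (φ : G.V → ℝ) (v : G.V) : Set G.E :=
  {e | G.Incident e v ∧ ∀ w, G.Incident e w → φ w ≤ φ v}

/-- A pairing provides a cycle on `[u, v]` that really passes through `v`, hence on two edges, which
are connected in the rest of its support. Conversely, connected edges give a cycle through `d`; the
partner `u` is the highest vertex for which such a cycle stays above it. Cycles on `[u, v)` miss `d`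
because they miss `v`, and cycles on `(u, v]` miss it by maximality. -/
theorem exists_hasPairing_iff {φ : G.V → ℝ} (hφ : Function.Injective φ) {v : G.V}
    (hthree : ∀ d ∈ G.edgesBelow φ v, ∀ d' ∈ G.edgesBelow φ v, d ≠ d' →
      ∀ e ∈ G.edgesBelow φ v, e = d ∨ e = d') {δ : ℝ} :
    (∃ u, HasPairing k G φ v u ∧ |φ v - φ u| ≤ δ) ↔
      ∃ d ∈ G.edgesBelow φ v, ∃ d' ∈ G.edgesBelow φ v, d ≠ d' ∧
        G.EdgeConn (φ ⁻¹' Ico (φ v - δ) (φ v)) d d' := by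
  have hinsert {a : ℝ} (ha : a ≤ φ v) : insert v (φ ⁻¹' Ico a (φ v)) = φ ⁻¹' Icc a (φ v) := by
    ext x
    simp only [mem_insert_iff, mem_preimage, mem_Ico, mem_Icc]
    constructor
    · rintro (rfl | h)
      exacts [⟨ha, le_rfl⟩, ⟨h.1, h.2.le⟩]
    · rintro ⟨h1, h2⟩
      rcases h2.eq_or_lt with h2 | h2
      exacts [Or.inl (hφ h2), Or.inr ⟨h1, h2⟩]
  have hnot (a : ℝ) : v ∉ φ ⁻¹' Ico a (φ v) := fun h => h.2.false
  constructor
  · rintro ⟨u, hvu, hδ⟩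
    obtain ⟨z, hz, hzB⟩ : ∃ z ∈ G.cycles k (φ ⁻¹' Icc (φ u) (φ v)),
        z ∉ G.cycles k (φ ⁻¹' Ico (φ u) (φ v)) := by
      by_contra! hcon
      exact hvu (le_sup_of_le_left hcon)
    have hzv : z ∉ G.cycles k (φ ⁻¹' Icc (φ u) (φ v) \ {v}) := by
      refine fun h => hzB (cycles_mono ?_ h)
      rintro x ⟨hx, hxv⟩
      exact ⟨hx.1, lt_of_le_of_ne hx.2 fun h => hxv (hφ h)⟩
    have hbelow {e : G.E} (he : G.Incident e v) (hze : z e ≠ 0) : e ∈ G.edgesBelow φ v :=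
      ⟨he, fun w hw => ((mem_cycles.1 hz).1 e hze w hw).2⟩
    obtain ⟨d, hd, hzd⟩ : ∃ d, G.Incident d v ∧ z d ≠ 0 := by
      by_contra! hcon
      by_cases hE : Nonempty G.E
      · exact hzv (mem_cycles_diff hz (d := hE.some) fun e he _ => hcon e he)
      · refine hzv (mem_cycles.2 ⟨fun e => absurd ⟨e⟩ hE, (mem_cycles.1 hz).2⟩)
    obtain ⟨d', hd', hne, hzd'⟩ : ∃ d', G.Incident d' v ∧ d' ≠ d ∧ z d' ≠ 0 := by
      by_contra! hcon
      exact hzv (mem_cycles_diff hz (d := d) hcon)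
    have huv : φ u ≤ φ v := ((mem_cycles.1 hz).1 d hzd v hd).1
    refine ⟨d, hbelow hd hzd, d', hbelow hd' hzd', hne.symm, ?_⟩
    rw [← hinsert huv] at hz
    refine EdgeConn.mono ?_ (edgeConn_of_mem_cycles hd hz hzd fun e he hze =>
      hthree d (hbelow hd hzd) d' (hbelow hd' hzd') hne.symm e (hbelow he hze))
    have := (abs_le.1 hδ).2
    exact fun x hx => ⟨by linarith [hx.1], hx.2⟩
  · rintro ⟨d, hd, d', hd', hne, hconn⟩
    obtain ⟨x₀, hx₀, hconn'⟩ : ∃ x₀, φ v - δ ≤ φ x₀ ∧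
        ∃ z ∈ G.cycles k (φ ⁻¹' Icc (φ x₀) (φ v)), z d ≠ 0 := by
      have hδ : 0 ≤ δ := by
        rcases Relation.ReflTransGen.cases_tail hconn with h | ⟨e, he, x, hx, -⟩
        · exact absurd h.symm hne
        · linarith [hx.1, hx.2]
      -- The bound `φ v - δ` need not be the height of a vertex; it is rounded up to the next one.
      obtain ⟨x₀, hx₀, hmin⟩ := exists_min_image {x | φ v - δ ≤ φ x} φ (toFinite _)
        ⟨v, by simp [hδ]⟩
      obtain ⟨z, hz, hzd⟩ := exists_cycle_of_edgeConn (k := k) (hnot _) hd.1 hd'.1 hne hconn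
      refine ⟨x₀, hx₀, z, cycles_mono ?_ hz, hzd⟩
      rw [hinsert (by linarith)]
      exact fun x hx => ⟨hmin x hx.1, hx.2⟩
    obtain ⟨u, ⟨z, hz, hzd⟩, hmax⟩ := exists_max_image
      {x | ∃ z ∈ G.cycles k (φ ⁻¹' Icc (φ x) (φ v)), z d ≠ 0} φ (toFinite _) ⟨x₀, hconn'⟩
    have huv : φ u ≤ φ v := ((mem_cycles.1 hz).1 d hzd v hd.1).1
    refine ⟨u, fun hle => ?_, ?_⟩
    swap
    · rw [abs_of_nonneg (by linarith)]
      linarith [hmax x₀ hconn']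
    have hB : ∀ y ∈ G.cycles k (φ ⁻¹' Ico (φ u) (φ v)), y d = 0 := by
      intro y hy
      by_contra h
      exact ((mem_cycles.1 hy).1 d h v hd.1).2.false
    have hC : ∀ y ∈ G.cycles k (φ ⁻¹' Ioc (φ u) (φ v)), y d = 0 := by
      intro y hy
      by_contra h
      -- With `x` the next vertex above `u`, the cycle lies in `[x, v]` and contradicts the choice
      -- of `u`.
      obtain ⟨x, hx, hmin⟩ := exists_min_image {x | φ u < φ x} φ (toFinite _)
        ⟨v, ((mem_cycles.1 hy).1 d h v hd.1).1⟩
      refine (hmax x ⟨y, cycles_mono ?_ hy, h⟩).not_gt hx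
      exact fun w hw => ⟨hmin w hw.1, hw.2⟩
    obtain ⟨y, hy, y', hy', hyy⟩ := Submodule.mem_sup.1 (hle hz)
    apply hzd
    rw [← hyy, Pi.add_apply, hB y hy, hC y' hy', add_zero]

theorem edgesBelow_f (v : G.V) : G.edgesBelow G.f v = {e | G.hi e = v} := by
  ext e
  constructor
  · rintro ⟨rfl | h, h'⟩
    · exact absurd (h' _ (Or.inr rfl)) (G.lo_lt_hi e).not_ge
    · exact h
  · rintro rfl
    refine ⟨Or.inr rfl, ?_⟩
    rintro w (rfl | rfl)
    exacts [(G.lo_lt_hi e).le, le_rfl]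

theorem edgesBelow_neg_f (v : G.V) : G.edgesBelow (fun x => - G.f x) v = {e | G.lo e = v} := by
  ext e
  constructor
  · rintro ⟨h | rfl, h'⟩
    · exact h
    · exact absurd (neg_le_neg_iff.1 (h' _ (Or.inl rfl))) (G.lo_lt_hi e).not_ge
  · rintro rfl
    refine ⟨Or.inl rfl, ?_⟩
    rintro w (rfl | rfl)
    exacts [le_rfl, neg_le_neg (G.lo_lt_hi e).le]

theorem eq_or_eq_of_card_le_two {α : Type*} {s : Set α} [Finite s] (hs : Nat.card s ≤ 2) {a b : α}
    (ha : a ∈ s) (hb : b ∈ s) (hab : a ≠ b) : ∀ c ∈ s, c = a ∨ c = b := by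
  intro c hc
  by_contra! hcon
  have hfin : s.Finite := toFinite s
  have : ({c, a, b} : Set α).ncard ≤ s.ncard := ncard_le_ncard (by
    rintro x (rfl | rfl | rfl)
    exacts [hc, ha, hb]) hfin
  rw [ncard_eq_three.2 ⟨c, a, b, hcon.1, hcon.2, hab, rfl⟩] at this
  rw [Nat.card_coe_set_eq] at hs
  omega

/-- This is where homology is traded for connectivity: the two alternatives treat `v` as the upper
end of a pair and, by reflection, as the lower end. Genericity enters through injectivity of `f` and
the bound of two edges on each side. The criterion does not involve the field. -/
theorem mem_shortLoopVertices_iff (hG : G.IsGeneric) {ε : ℝ} (v : G.V) :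
    v ∈ G.shortLoopVertices k ε ↔
      (∃ d d', G.hi d = v ∧ G.hi d' = v ∧ d ≠ d' ∧
        G.EdgeConn {x | G.f v - 2 * ε ≤ G.f x ∧ G.f x < G.f v} d d') ∨
      (∃ d d', G.lo d = v ∧ G.lo d' = v ∧ d ≠ d' ∧
        G.EdgeConn {x | G.f v < G.f x ∧ G.f x ≤ G.f v + 2 * ε} d d') := by
  have hdown : Nat.card {e | G.hi e = v} ≤ 2 := by
    change G.downDegree v ≤ 2
    rcases hG.2 v with h | h | h | h <;> rw [h.1] <;> norm_num
  have hup : Nat.card {e | G.lo e = v} ≤ 2 := by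
    change G.upDegree v ≤ 2
    rcases hG.2 v with h | h | h | h <;> rw [h.2] <;> norm_num
  have h1 := exists_hasPairing_iff (k := k) hG.1 (v := v) (δ := 2 * ε) (by
    rw [edgesBelow_f]
    exact fun d hd d' hd' => eq_or_eq_of_card_le_two hdown hd hd')
  have h2 := exists_hasPairing_iff (k := k) (neg_injective.comp hG.1) (v := v) (δ := 2 * ε) (by
    change ∀ d ∈ G.edgesBelow (fun x => - G.f x) v,
      ∀ d' ∈ G.edgesBelow (fun x => - G.f x) v, d ≠ d' →
      ∀ e ∈ G.edgesBelow (fun x => - G.f x) v, e = d ∨ e = d'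
    rw [edgesBelow_neg_f]
    exact fun d hd d' hd' => eq_or_eq_of_card_le_two hup hd hd')
  have e1 : G.f ⁻¹' Ico (G.f v - 2 * ε) (G.f v) =
      {x | G.f v - 2 * ε ≤ G.f x ∧ G.f x < G.f v} := rfl
  have e2 : (fun x => - G.f x) ⁻¹' Ico (- G.f v - 2 * ε) (- G.f v) =
      {x | G.f v < G.f x ∧ G.f x ≤ G.f v + 2 * ε} := by
    ext x
    simp only [mem_preimage, mem_Ico, mem_ofPred_eq]
    constructor <;> rintro ⟨h, h'⟩ <;> constructor <;> linarith
  change (∃ u, HasPairing k G (fun x => - G.f x) v u ∧ |-G.f v - -G.f u| ≤ 2 * ε) ↔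
    ∃ d ∈ G.edgesBelow (fun x => - G.f x) v, ∃ d' ∈ G.edgesBelow (fun x => - G.f x) v, d ≠ d' ∧
        G.EdgeConn ((fun x => - G.f x) ⁻¹' Ico (- G.f v - 2 * ε) (- G.f v)) d d' at h2
  rw [edgesBelow_f, e1] at h1
  rw [edgesBelow_neg_f, e2] at h2
  have h3 : v ∈ G.shortLoopVertices k ε ↔ (∃ u, HasPairing k G G.f v u ∧ |G.f v - G.f u| ≤ 2 * ε) ∨
      (∃ u, HasPairing k G (fun x => - G.f x) v u ∧ |-G.f v - -G.f u| ≤ 2 * ε) := by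
    constructor
    · rintro ⟨a, b, hab, hδ, rfl | rfl⟩
      · exact Or.inl ⟨b, (ext1Multiplicity_pos_iff _ _).1 hab, hδ⟩
      · refine Or.inr ⟨a, (hasPairing_neg_iff _ _ _).2 ((ext1Multiplicity_pos_iff _ _).1 hab), ?_⟩
        rwa [neg_sub_neg]
    · rintro (⟨u, hu, hδ⟩ | ⟨u, hu, hδ⟩)
      · exact ⟨v, u, (ext1Multiplicity_pos_iff _ _).2 hu, hδ, Or.inl rfl⟩
      · refine ⟨u, v, (ext1Multiplicity_pos_iff _ _).2 ((hasPairing_neg_iff _ _ _).1 hu), ?_,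
          Or.inr rfl⟩
        rwa [neg_sub_neg] at hδ
  rw [h3, h1, h2]
  simp only [mem_ofPred_eq, exists_and_left]

end Homology

end ReebGraph

namespace ReebGraph

open Set

section Levels

variable {G : ReebGraph.{u}} {ε : ℝ}

/-! ### The arcs in the smoothing -/

variable (G ε) in
/-- The heights at which a vertex enters or leaves the window. -/
def levels : Set ℝ := range (fun v => G.f v - ε) ∪ range (fun v => G.f v + ε)

theorem sub_mem_levels (v : G.V) : G.f v - ε ∈ G.levels ε := Or.inl ⟨v, rfl⟩

theorem add_mem_levels (v : G.V) : G.f v + ε ∈ G.levels ε := Or.inr ⟨v, rfl⟩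

theorem finite_levels : (G.levels ε).Finite := (finite_range _).union (finite_range _)

theorem mem_window_iff {c : ℝ} {v : G.V} : v ∈ G.window ε c ↔ G.f v - ε ≤ c ∧ c ≤ G.f v + ε := by
  change |G.f v - c| ≤ ε ↔ _
  rw [abs_le]
  constructor <;> rintro ⟨h1, h2⟩ <;> constructor <;> linarith

variable (G ε) in
/-- The heights of the arc in the smoothing that is traced out by an edge. -/
def arcRange (e : G.E) : Set ℝ := Icc (G.f (G.lo e) - ε) (G.f (G.hi e) + ε)

theorem Incident.mem_arcRange {e : G.E} {v : G.V} (h : G.Incident e v) {c : ℝ}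
    (hv : v ∈ G.window ε c) : c ∈ G.arcRange ε e := by
  rw [mem_window_iff] at hv
  have := G.lo_lt_hi e
  rcases h with rfl | rfl <;> constructor <;> linarith [hv.1, hv.2]

variable (hε : 0 < ε) (hf : G.IsFunctionGeneric) (hinc : ∀ v, ∃ e, G.Incident e v)

-- Between levels the window at `s` is contained in the window at `t`, also when `t` is an end of
-- the gap. So connected edges stay connected.
include hε hf hinc in
theorem isArcCover_smoothing :
    IsArcCover (smoothingHeight G.height ε) (fun e => G.f (G.lo e) - ε) (fun e => G.f (G.hi e) + ε)
      (G.smoothArc hε) (G.levels ε) where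
  continuous_arc := continuous_smoothArc hε
  height_arc _ _ ht := smoothingHeight_smoothArc hε ht
  exists_eq y := exists_smoothArc_eq hε hinc y
  left_mem e := sub_mem_levels _
  right_mem e := add_mem_levels _
  transfer e e' s t hs _ ht _ h1 h2 h := by
    rw [smoothArc_eq_iff hε hf hinc hs] at h
    refine smoothArc_eq_of_edgeConn hε (h.mono fun v hv => ?_)
    rw [mem_window_iff] at hv ⊢
    exact ⟨h2 _ (sub_mem_levels v) hv.1, h1 _ (add_mem_levels v) hv.2⟩
  finite_index := inferInstance
  finite_levels := finite_levels

/-! ### Germs of arcs at a point of the smoothing -/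

/-- The points at height `t` of the arcs through the point `y` at height `c`. -/
def germs (c t : ℝ) (y : Smoothing G.height ε) : Set (Smoothing G.height ε) :=
  {z | ∃ e, c ∈ G.arcRange ε e ∧ t ∈ G.arcRange ε e ∧ G.smoothArc hε e t = z ∧
    G.smoothArc hε e c = y}

include hf hinc

/-- When no vertex is lost, connected edges stay connected, so the arcs through `y` do not split; no
arc ends either, so there is a germ. -/
theorem ncard_germs_of_window_subset {c t : ℝ} (hw : G.window ε c ⊆ G.window ε t)
    (hI : ∀ e, c ∈ G.arcRange ε e → t ∈ G.arcRange ε e) {y : Smoothing G.height ε}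
    (hy : smoothingHeight G.height ε y = c) : (germs hε c t y).ncard = 1 := by
  obtain ⟨e, he, hey⟩ := exists_smoothArc_eq hε hinc y
  rw [hy] at he hey
  refine ncard_eq_one.2 ⟨G.smoothArc hε e t, Subset.antisymm ?_ ?_⟩
  · rintro _ ⟨e', he', -, rfl, hey'⟩
    rw [← hey, smoothArc_eq_iff hε hf hinc he'] at hey'
    exact smoothArc_eq_of_edgeConn hε (hey'.mono hw)
  · rintro _ rfl
    exact ⟨e, he, hI e he, rfl, hey⟩

/-- Only `v` is lost. If `y` is not on an arc of an edge at `v`, then chains of edges within its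
class never use `v`, and none of its arcs ends. -/
theorem ncard_germs_of_ne {c t : ℝ} {v : G.V} (hw : G.window ε c ⊆ insert v (G.window ε t))
    (hI : ∀ e, c ∈ G.arcRange ε e → t ∉ G.arcRange ε e → G.Incident e v)
    {y : Smoothing G.height ε} (hy : smoothingHeight G.height ε y = c)
    (hyv : ∀ e, G.Incident e v → G.smoothArc hε e c ≠ y) : (germs hε c t y).ncard = 1 := by
  obtain ⟨e, he, hey⟩ := exists_smoothArc_eq hε hinc y
  rw [hy] at he hey
  have hconn {e' : G.E} (h : G.EdgeConn (G.window ε c) e e') : G.EdgeConn (G.window ε t) e e' := by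
    induction h with
    | refl => exact EdgeConn.refl _ _
    | tail h h' ih =>
      obtain ⟨w, hw', h1, h2⟩ := h'
      refine ih.trans (EdgeAdj.edgeConn ⟨w, (hw hw').resolve_left ?_, h1, h2⟩)
      rintro rfl
      exact hyv _ h1 ((smoothArc_eq_of_edgeConn hε h).symm.trans hey)
  refine ncard_eq_one.2 ⟨G.smoothArc hε e t, Subset.antisymm ?_ ?_⟩
  · rintro _ ⟨e', he', -, rfl, hey'⟩
    rw [← hey, eq_comm, smoothArc_eq_iff hε hf hinc he] at hey'
    exact (smoothArc_eq_of_edgeConn hε (hconn hey')).symm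
  · rintro _ rfl
    refine ⟨e, he, ?_, rfl, hey⟩
    by_contra het
    exact hyv e (hI e he het) hey

/-- A chain from any edge of the class to `d` can be followed until it first reaches an edge at `v`.
Up to there it uses vertices other than `v`, which are still in the window at `t`. So every germ is
that of an edge at `v`. -/
theorem germs_vertex {c t : ℝ} {v : G.V} (hv : v ∈ G.window ε c)
    (hw : G.window ε c ⊆ insert v (G.window ε t)) {d : G.E} (hd : G.Incident d v) :
    germs hε c t (G.smoothArc hε d c) =
      (fun e => G.smoothArc hε e t) '' {e | G.Incident e v ∧ t ∈ G.arcRange ε e} := by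
  have hconn (e : G.E) (h : G.EdgeConn (G.window ε c) e d) (ht : t ∈ G.arcRange ε e) :
      ∃ e', G.Incident e' v ∧ t ∈ G.arcRange ε e' ∧ G.EdgeConn (G.window ε t) e e' := by
    induction h using Relation.ReflTransGen.head_induction_on with
    | refl => exact ⟨d, hd, ht, EdgeConn.refl _ _⟩
    | @head e e₁ h _ ih =>
      by_cases he : G.Incident e v
      · exact ⟨e, he, ht, EdgeConn.refl _ _⟩
      · obtain ⟨w, hw', h1, h2⟩ := h
        have hwt : w ∈ G.window ε t := by
          refine (hw hw').resolve_left ?_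
          rintro rfl
          exact he h1
        obtain ⟨e', h3, h4, h5⟩ := ih (h2.mem_arcRange hwt)
        exact ⟨e', h3, h4, EdgeConn.trans (EdgeAdj.edgeConn ⟨w, hwt, h1, h2⟩) h5⟩
  ext z
  constructor
  · rintro ⟨e, he, het, rfl, hey⟩
    rw [smoothArc_eq_iff hε hf hinc he] at hey
    obtain ⟨e', h1, h2, h3⟩ := hconn e hey het
    exact ⟨e', ⟨h1, h2⟩, (smoothArc_eq_of_edgeConn hε h3).symm⟩
  · rintro ⟨e, ⟨h1, h2⟩, rfl⟩
    exact ⟨e, h1.mem_arcRange hv, h2, rfl,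
      smoothArc_eq_of_edgeConn hε (EdgeAdj.edgeConn ⟨v, hv, h1, hd⟩)⟩

omit hf hinc

/-! ### Degrees in the smoothing -/

theorem exists_gt_of_finite {C : Set ℝ} (hC : C.Finite) (c : ℝ) :
    ∃ t, c < t ∧ ∀ a ∈ C, c < a → t < a := by
  by_cases h : {a ∈ C | c < a}.Nonempty
  · obtain ⟨m, ⟨-, hm⟩, hmin⟩ := exists_min_image _ id (hC.subset (sep_subset C (c < ·))) h
    refine ⟨(c + m) / 2, by linarith, fun a ha hca => ?_⟩
    have : m ≤ a := hmin a ⟨ha, hca⟩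
    linarith
  · exact ⟨c + 1, by linarith, fun a ha hca => absurd ⟨a, ha, hca⟩ h⟩

theorem exists_lt_of_finite {C : Set ℝ} (hC : C.Finite) (c : ℝ) :
    ∃ t, t < c ∧ ∀ a ∈ C, a < c → a < t := by
  by_cases h : {a ∈ C | a < c}.Nonempty
  · obtain ⟨m, ⟨-, hm⟩, hmax⟩ := exists_max_image _ id (hC.subset (sep_subset C (· < c))) h
    refine ⟨(c + m) / 2, by linarith, fun a ha hca => ?_⟩
    have : a ≤ m := hmax a ⟨ha, hca⟩
    linarith
  · exact ⟨c - 1, by linarith, fun a ha hca => absurd ⟨a, ha, hca⟩ h⟩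

variable (G ε) in
/-- The down-edges of `v` belong to a loop of height at most `2ε` below `v`. -/
def LoopBelow (v : G.V) : Prop :=
  ∃ d d', G.hi d = v ∧ G.hi d' = v ∧ d ≠ d' ∧
    G.EdgeConn {x | G.f v - 2 * ε ≤ G.f x ∧ G.f x < G.f v} d d'

variable (G ε) in
/-- The up-edges of `v` belong to a loop of height at most `2ε` above `v`. -/
def LoopAbove (v : G.V) : Prop :=
  ∃ d d', G.lo d = v ∧ G.lo d' = v ∧ d ≠ d' ∧
    G.EdgeConn {x | G.f v < G.f x ∧ G.f x ≤ G.f v + 2 * ε} d d'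

variable (G) in
/-- The class in the smoothing of a vertex, shifted down. -/
noncomputable def lowerPt (v : G.V) : Smoothing G.height ε :=
  smoothingMk G.height ε (G.vertexPt v) ⟨-ε, left_mem_Icc.2 (neg_le_self hε.le)⟩

variable (G) in
/-- The class in the smoothing of a vertex, shifted up. -/
noncomputable def upperPt (v : G.V) : Smoothing G.height ε :=
  smoothingMk G.height ε (G.vertexPt v) ⟨ε, right_mem_Icc.2 (neg_le_self hε.le)⟩

theorem smoothArc_sub {e : G.E} {v : G.V} (h : G.Incident e v) :
    G.smoothArc hε e (G.f v - ε) = G.lowerPt hε v :=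
  (smoothingMk_vertexPt hε h _ (sub_eq_add_neg _ _)).symm

theorem smoothArc_add {e : G.E} {v : G.V} (h : G.Incident e v) :
    G.smoothArc hε e (G.f v + ε) = G.upperPt hε v :=
  (smoothingMk_vertexPt hε h ⟨ε, right_mem_Icc.2 (neg_le_self hε.le)⟩ rfl).symm

theorem smoothingHeight_lowerPt (v : G.V) :
    smoothingHeight G.height ε (G.lowerPt hε v) = G.f v - ε := (sub_eq_add_neg _ _).symm

theorem smoothingHeight_upperPt (v : G.V) :
    smoothingHeight G.height ε (G.upperPt hε v) = G.f v + ε := rfl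

theorem ncard_image_eq_one {α β : Type*} {F : α → β} {s : Set α} [Finite s]
    (hs : Nat.card s ≤ 2) {a b : α} (ha : a ∈ s) (hb : b ∈ s) (hab : a ≠ b) (hF : F a = F b) :
    (F '' s).ncard = 1 := by
  refine ncard_eq_one.2 ⟨F a, Subset.antisymm ?_ ?_⟩
  · rintro _ ⟨c, hc, rfl⟩
    rcases eq_or_eq_of_card_le_two hs ha hb hab c hc with rfl | rfl
    exacts [rfl, hF.symm]
  · rintro _ rfl
    exact ⟨a, ha, rfl⟩

/-- The only use of the condition on `2ε`: no vertex leaves the window at a height at which another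
one enters. -/
theorem add_ne_sub (hne : ∀ v w : G.V, 2 * ε ≠ |G.f v - G.f w|) (hε : 0 < ε) (v w : G.V) :
    G.f v + ε ≠ G.f w - ε := by
  intro h
  refine hne v w ?_
  rw [abs_of_nonpos (by linarith)]
  linarith

variable (hdeg : ∀ v, G.downDegree v ≤ 2 ∧ G.upDegree v ≤ 2)
  (hne : ∀ v w : G.V, 2 * ε ≠ |G.f v - G.f w|)
include hf hinc hdeg hne

/-- Upwards from `f v - ε` no vertex leaves the window. Downwards exactly `v` leaves, and what is
left of the window is `[f v - 2ε, f v)`. So only the class of `v` can split or end, and its germs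
are the down-edges of `v` up to connection in that interval. -/
theorem degree_at_lower_level (v : G.V) (y : (isArcCover_smoothing hε hf hinc).graph.V)
    (hy : smoothingHeight G.height ε y.1 = G.f v - ε) :
    (isArcCover_smoothing hε hf hinc).graph.upDegree y = 1 ∧
    (y.1 = G.lowerPt hε v → ¬ G.LoopBelow ε v →
      (isArcCover_smoothing hε hf hinc).graph.downDegree y = G.downDegree v) ∧
    (y.1 ≠ G.lowerPt hε v ∨ G.LoopBelow ε v →
      (isArcCover_smoothing hε hf hinc).graph.downDegree y = 1) := by
  constructor
  · obtain ⟨t, hct, ht⟩ := exists_gt_of_finite (finite_levels (G := G) (ε := ε)) (G.f v - ε)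
    rw [IsArcCover.upDegree_graph _ y (t := t) (by rwa [hy]) (by rwa [hy]), hy]
    convert ncard_germs_of_window_subset hε hf hinc (c := G.f v - ε) (t := t) ?_ ?_ hy using 2
    · ext z
      constructor
      · rintro ⟨e, h1, h2, h3⟩
        exact ⟨e, ⟨h1, hct.le.trans h2⟩, ⟨h1.trans hct.le, h2⟩, h3⟩
      · rintro ⟨e, h1, h2, h3⟩
        exact ⟨e, h1.1, h2.2, h3⟩
    · intro w hw
      rw [mem_window_iff] at hw ⊢
      exact ⟨hw.1.trans hct.le,
        (ht _ (add_mem_levels w) (lt_of_le_of_ne hw.2 (add_ne_sub hne hε w v).symm)).le⟩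
    · intro e he
      exact ⟨he.1.trans hct.le,
        (ht _ (add_mem_levels _) (lt_of_le_of_ne he.2 (add_ne_sub hne hε _ v).symm)).le⟩
  · obtain ⟨t, hct, ht⟩ := exists_lt_of_finite (finite_levels (G := G) (ε := ε)) (G.f v - ε)
    rw [IsArcCover.downDegree_graph _ y (t := t) (by rwa [hy]) (by rwa [hy]), hy]
    have hgerms : {z | ∃ e, G.f (G.lo e) - ε ≤ t ∧ G.f v - ε ≤ G.f (G.hi e) + ε ∧
        G.smoothArc hε e t = z ∧ G.smoothArc hε e (G.f v - ε) = y.1} =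
        germs hε (G.f v - ε) t y.1 := by
      ext z
      constructor
      · rintro ⟨e, h1, h2, h3⟩
        exact ⟨e, ⟨h1.trans hct.le, h2⟩, ⟨h1, hct.le.trans h2⟩, h3⟩
      · rintro ⟨e, h1, h2, h3⟩
        exact ⟨e, h2.1, h1.2, h3⟩
    rw [hgerms]
    have hwt : G.window ε t = {x | G.f v - 2 * ε ≤ G.f x ∧ G.f x < G.f v} := by
      ext w
      rw [mem_window_iff]
      constructor
      · rintro ⟨h1, h2⟩
        have h3 : G.f v - ε ≤ G.f w + ε := not_lt.1 fun h => (ht _ (add_mem_levels w) h).not_ge h2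
        constructor <;> linarith
      · rintro ⟨h1, h2⟩
        have := ht _ (sub_mem_levels w) (by linarith)
        constructor <;> linarith
    have hv : v ∈ G.window ε (G.f v - ε) := by
      rw [mem_window_iff]
      constructor <;> linarith
    have hw : G.window ε (G.f v - ε) ⊆ insert v (G.window ε t) := by
      intro w hw
      rw [hwt]
      rw [mem_window_iff] at hw
      rcases eq_or_ne w v with h | h
      · exact Or.inl h
      · exact Or.inr ⟨by linarith [hw.2],
          lt_of_le_of_ne (by linarith [hw.1]) fun h' => h (hf h')⟩
    have hrange (e : G.E) (he : G.hi e = v) : t ∈ G.arcRange ε e := by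
      have := G.lo_lt_hi e
      rw [he] at this
      refine ⟨(ht _ (sub_mem_levels _) (by linarith)).le, ?_⟩
      rw [he]
      linarith
    have hI (e : G.E) (he : G.f v - ε ∈ G.arcRange ε e) (het : t ∉ G.arcRange ε e) :
        G.lo e = v := by
      by_contra h
      refine het ⟨(ht _ (sub_mem_levels _) (lt_of_le_of_ne he.1 fun h' => h (hf ?_))).le,
        hct.le.trans he.2⟩
      linarith
    have hset : {e | G.Incident e v ∧ t ∈ G.arcRange ε e} = {e | G.hi e = v} := by
      ext e
      constructor
      · rintro ⟨rfl | h, ht'⟩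
        · exact absurd ht'.1 hct.not_ge
        · exact h
      · exact fun h => ⟨Or.inr h, hrange e h⟩
    have himage (hyv : y.1 = G.lowerPt hε v) : germs hε (G.f v - ε) t y.1 =
        (fun e => G.smoothArc hε e t) '' {e | G.hi e = v} := by
      obtain ⟨d, hd⟩ := hinc v
      rw [hyv, ← smoothArc_sub hε hd, germs_vertex hε hf hinc hv hw hd, hset]
    refine ⟨fun hyv hloop => ?_, fun h => ?_⟩
    · rw [himage hyv, InjOn.ncard_image]
      · rfl
      · intro d hd d' hd' hdd
        by_contra hne'
        refine hloop ⟨d, d', hd, hd', hne', ?_⟩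
        rw [← hwt]
        exact (smoothArc_eq_iff hε hf hinc (hrange d hd)).1 hdd
    · by_cases hyv : y.1 = G.lowerPt hε v
      · obtain ⟨d, d', hd, hd', hne', hconn⟩ := h.resolve_left (not_not.2 hyv)
        rw [himage hyv]
        refine ncard_image_eq_one (hdeg v).1 hd hd' hne' ?_
        rw [← hwt] at hconn
        exact smoothArc_eq_of_edgeConn hε hconn
      · exact ncard_germs_of_ne hε hf hinc hw (fun e he het => Or.inl (hI e he het)) hy
          fun e he h => hyv (h.symm.trans (smoothArc_sub hε he))

/-- The reflection of `degree_at_lower_level`: here `v` is lost on the way up, and the remaining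
window is `(f v, f v + 2ε]`. -/
theorem degree_at_upper_level (v : G.V) (y : (isArcCover_smoothing hε hf hinc).graph.V)
    (hy : smoothingHeight G.height ε y.1 = G.f v + ε) :
    (isArcCover_smoothing hε hf hinc).graph.downDegree y = 1 ∧
    (y.1 = G.upperPt hε v → ¬ G.LoopAbove ε v →
      (isArcCover_smoothing hε hf hinc).graph.upDegree y = G.upDegree v) ∧
    (y.1 ≠ G.upperPt hε v ∨ G.LoopAbove ε v →
      (isArcCover_smoothing hε hf hinc).graph.upDegree y = 1) := by
  constructor
  · obtain ⟨t, hct, ht⟩ := exists_lt_of_finite (finite_levels (G := G) (ε := ε)) (G.f v + ε)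
    rw [IsArcCover.downDegree_graph _ y (t := t) (by rwa [hy]) (by rwa [hy]), hy]
    convert ncard_germs_of_window_subset hε hf hinc (c := G.f v + ε) (t := t) ?_ ?_ hy using 2
    · ext z
      constructor
      · rintro ⟨e, h1, h2, h3⟩
        exact ⟨e, ⟨h1.trans hct.le, h2⟩, ⟨h1, hct.le.trans h2⟩, h3⟩
      · rintro ⟨e, h1, h2, h3⟩
        exact ⟨e, h2.1, h1.2, h3⟩
    · intro w hw
      rw [mem_window_iff] at hw ⊢
      exact ⟨(ht _ (sub_mem_levels w) (lt_of_le_of_ne hw.1 (add_ne_sub hne hε v w).symm)).le,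
        hct.le.trans hw.2⟩
    · intro e he
      exact ⟨(ht _ (sub_mem_levels _) (lt_of_le_of_ne he.1 (add_ne_sub hne hε v _).symm)).le,
        hct.le.trans he.2⟩
  · obtain ⟨t, hct, ht⟩ := exists_gt_of_finite (finite_levels (G := G) (ε := ε)) (G.f v + ε)
    rw [IsArcCover.upDegree_graph _ y (t := t) (by rwa [hy]) (by rwa [hy]), hy]
    have hgerms : {z | ∃ e, G.f (G.lo e) - ε ≤ G.f v + ε ∧ t ≤ G.f (G.hi e) + ε ∧
        G.smoothArc hε e t = z ∧ G.smoothArc hε e (G.f v + ε) = y.1} =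
        germs hε (G.f v + ε) t y.1 := by
      ext z
      constructor
      · rintro ⟨e, h1, h2, h3⟩
        exact ⟨e, ⟨h1, hct.le.trans h2⟩, ⟨h1.trans hct.le, h2⟩, h3⟩
      · rintro ⟨e, h1, h2, h3⟩
        exact ⟨e, h1.1, h2.2, h3⟩
    rw [hgerms]
    have hwt : G.window ε t = {x | G.f v < G.f x ∧ G.f x ≤ G.f v + 2 * ε} := by
      ext w
      rw [mem_window_iff]
      constructor
      · rintro ⟨h1, h2⟩
        have h3 : G.f w - ε ≤ G.f v + ε := not_lt.1 fun h => (ht _ (sub_mem_levels w) h).not_ge h1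
        constructor <;> linarith
      · rintro ⟨h1, h2⟩
        have := ht _ (add_mem_levels w) (by linarith)
        constructor <;> linarith
    have hv : v ∈ G.window ε (G.f v + ε) := by
      rw [mem_window_iff]
      constructor <;> linarith
    have hw : G.window ε (G.f v + ε) ⊆ insert v (G.window ε t) := by
      intro w hw
      rw [hwt]
      rw [mem_window_iff] at hw
      rcases eq_or_ne w v with h | h
      · exact Or.inl h
      · exact Or.inr ⟨lt_of_le_of_ne (by linarith [hw.2]) fun h' => h (hf h'.symm),
          by linarith [hw.1]⟩
    have hrange (e : G.E) (he : G.lo e = v) : t ∈ G.arcRange ε e := by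
      have := G.lo_lt_hi e
      rw [he] at this
      refine ⟨?_, (ht _ (add_mem_levels _) (by linarith)).le⟩
      rw [he]
      linarith
    have hI (e : G.E) (he : G.f v + ε ∈ G.arcRange ε e) (het : t ∉ G.arcRange ε e) :
        G.hi e = v := by
      by_contra h
      refine het ⟨he.1.trans hct.le,
        (ht _ (add_mem_levels _) (lt_of_le_of_ne he.2 fun h' => h (hf ?_))).le⟩
      linarith
    have hset : {e | G.Incident e v ∧ t ∈ G.arcRange ε e} = {e | G.lo e = v} := by
      ext e
      constructor
      · rintro ⟨h | rfl, ht'⟩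
        · exact h
        · exact absurd ht'.2 hct.not_ge
      · exact fun h => ⟨Or.inl h, hrange e h⟩
    have himage (hyv : y.1 = G.upperPt hε v) : germs hε (G.f v + ε) t y.1 =
        (fun e => G.smoothArc hε e t) '' {e | G.lo e = v} := by
      obtain ⟨d, hd⟩ := hinc v
      rw [hyv, ← smoothArc_add hε hd, germs_vertex hε hf hinc hv hw hd, hset]
    refine ⟨fun hyv hloop => ?_, fun h => ?_⟩
    · rw [himage hyv, InjOn.ncard_image]
      · rfl
      · intro d hd d' hd' hdd
        by_contra hne'
        refine hloop ⟨d, d', hd, hd', hne', ?_⟩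
        rw [← hwt]
        exact (smoothArc_eq_iff hε hf hinc (hrange d hd)).1 hdd
    · by_cases hyv : y.1 = G.upperPt hε v
      · obtain ⟨d, d', hd, hd', hne', hconn⟩ := h.resolve_left (not_not.2 hyv)
        rw [himage hyv]
        refine ncard_image_eq_one (hdeg v).2 hd hd' hne' ?_
        rw [← hwt] at hconn
        exact smoothArc_eq_of_edgeConn hε hconn
      · exact ncard_germs_of_ne hε hf hinc hw (fun e he het => Or.inr (hI e he het)) hy
          fun e he h => hyv (h.symm.trans (smoothArc_add hε he))

end Levels

end ReebGraph

namespace ReebGraph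

open Set

/-! ### The surviving vertices and the arc model of the smoothing. -/

section Smoothing

variable {G : ReebGraph.{u}} {ε : ℝ}

theorem IsGeneric.exists_incident (hG : G.IsGeneric) (v : G.V) : ∃ e, G.Incident e v := by
  have hup (h : G.upDegree v ≠ 0) : ∃ e, G.Incident e v := by
    have := (Nat.card_ne_zero.1 h).1
    exact ⟨this.some.1, Or.inl this.some.2⟩
  have hdown (h : G.downDegree v ≠ 0) : ∃ e, G.Incident e v := by
    have := (Nat.card_ne_zero.1 h).1
    exact ⟨this.some.1, Or.inr this.some.2⟩
  rcases hG.2 v with h | h | h | h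
  · exact hup (by simp [h.2])
  · exact hup (by simp [h.2])
  · exact hup (by simp [h.2])
  · exact hdown (by simp [h.1])

theorem IsGeneric.degree_le_two (hG : G.IsGeneric) (v : G.V) :
    G.downDegree v ≤ 2 ∧ G.upDegree v ≤ 2 := by
  rcases hG.2 v with h | h | h | h <;> rw [h.1, h.2] <;> norm_num

theorem IsGeneric.isLocalMin_or_isDownFork_iff (hG : G.IsGeneric) (v : G.V) :
    G.IsLocalMin v ∨ G.IsDownFork v ↔ G.upDegree v = 1 ∧ G.downDegree v ≠ 1 := by
  rcases hG.2 v with h | h | h | h <;>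
    simp [IsLocalMin, IsDownFork, h.1, h.2]

theorem IsGeneric.isLocalMax_or_isUpFork_iff (hG : G.IsGeneric) (v : G.V) :
    G.IsLocalMax v ∨ G.IsUpFork v ↔ G.downDegree v = 1 ∧ G.upDegree v ≠ 1 := by
  rcases hG.2 v with h | h | h | h <;>
    simp [IsLocalMax, IsUpFork, h.1, h.2]

theorem not_loopAbove {v : G.V} (h : G.upDegree v = 1) : ¬ G.LoopAbove ε v := by
  rintro ⟨d, d', hd, hd', hne, -⟩
  have := (Nat.card_eq_one_iff_unique.1 h).1
  exact hne (congrArg Subtype.val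
    (Subsingleton.elim (⟨d, hd⟩ : {e // G.lo e = v}) ⟨d', hd'⟩))

theorem not_loopBelow {v : G.V} (h : G.downDegree v = 1) : ¬ G.LoopBelow ε v := by
  rintro ⟨d, d', hd, hd', hne, -⟩
  have := (Nat.card_eq_one_iff_unique.1 h).1
  exact hne (congrArg Subtype.val
    (Subsingleton.elim (⟨d, hd⟩ : {e // G.hi e = v}) ⟨d', hd'⟩))

open Classical in
variable (G) in
/-- The point of the smoothing to which a vertex moves. -/
noncomputable def movedPt (hε : 0 < ε) (v : G.V) : Smoothing G.height ε :=
  if G.IsLocalMin v ∨ G.IsDownFork v then G.lowerPt hε v else G.upperPt hε v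

/-- This yields function-genericity of the smoothing, and shows that different vertices move to
different points. -/
theorem smoothingHeight_movedPt_injective (hε : 0 < ε) (hf : G.IsFunctionGeneric)
    (hne : ∀ v w : G.V, 2 * ε ≠ |G.f v - G.f w|) :
    Function.Injective fun v => smoothingHeight G.height ε (G.movedPt hε v) := by
  intro v w h
  simp only [movedPt] at h
  split_ifs at h <;>
    simp only [smoothingHeight_lowerPt, smoothingHeight_upperPt, sub_left_inj,
      add_left_inj] at h
  · exact hf h
  · exact absurd h.symm (add_ne_sub hne hε w v)
  · exact absurd h (add_ne_sub hne hε v w)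
  · exact hf h

/-- The smoothing of a generic Reeb graph has an arc model, the vertices of which are the moved
vertices outside short loops, with their degrees. -/
theorem exists_arcModel_smoothing (k : Type w) [Field k] (hG : G.IsGeneric) (hε : 0 < ε)
    (hne : ∀ v w : G.V, 2 * ε ≠ |G.f v - G.f w|) :
    ∃ (H : ReebGraph.{u}) (p : H.V → Smoothing G.height ε) (γ : H.E → ℝ → Smoothing G.height ε),
      H.IsArcModel (smoothingHeight G.height ε) p γ ∧
      range p = G.movedPt hε '' (G.shortLoopVertices k ε)ᶜ ∧
      ∀ x v, v ∉ G.shortLoopVertices k ε → p x = G.movedPt hε v →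
        H.downDegree x = G.downDegree v ∧ H.upDegree x = G.upDegree v := by
  classical
  have hf := hG.1
  have hinc := hG.exists_incident
  set hc := isArcCover_smoothing hε hf hinc with hcdef
  let U : Smoothing G.height ε → ℕ := fun y =>
    -- The value `0` off the levels is never used, as all vertices of the elementary graph lie at
    -- levels.
    if h : smoothingHeight G.height ε y ∈ G.levels ε then hc.graph.upDegree ⟨y, h⟩ else 0
  let D : Smoothing G.height ε → ℕ := fun y =>
    if h : smoothingHeight G.height ε y ∈ G.levels ε then hc.graph.downDegree ⟨y, h⟩ else 0
  have hU {y : Smoothing G.height ε} (h : smoothingHeight G.height ε y ∈ G.levels ε) :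
      U y = hc.graph.upDegree ⟨y, h⟩ := dif_pos h
  have hD {y : Smoothing G.height ε} (h : smoothingHeight G.height ε y ∈ G.levels ε) :
      D y = hc.graph.downDegree ⟨y, h⟩ := dif_pos h
  have hlower (v : G.V) (y : Smoothing G.height ε) (hy : smoothingHeight G.height ε y = G.f v - ε) :
      U y = 1 ∧ (y = G.lowerPt hε v → ¬ G.LoopBelow ε v → D y = G.downDegree v) ∧
        (y ≠ G.lowerPt hε v ∨ G.LoopBelow ε v → D y = 1) := by
    have hyC : smoothingHeight G.height ε y ∈ G.levels ε := hy ▸ sub_mem_levels v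
    rw [hU hyC, hD hyC]
    exact degree_at_lower_level hε hf hinc hG.degree_le_two hne v ⟨y, hyC⟩ hy
  have hupper (v : G.V) (y : Smoothing G.height ε) (hy : smoothingHeight G.height ε y = G.f v + ε) :
      D y = 1 ∧ (y = G.upperPt hε v → ¬ G.LoopAbove ε v → U y = G.upDegree v) ∧
        (y ≠ G.upperPt hε v ∨ G.LoopAbove ε v → U y = 1) := by
    have hyC : smoothingHeight G.height ε y ∈ G.levels ε := hy ▸ add_mem_levels v
    rw [hU hyC, hD hyC]
    exact degree_at_upper_level hε hf hinc hG.degree_le_two hne v ⟨y, hyC⟩ hy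
  have hmoved (v : G.V) (hv : v ∉ G.shortLoopVertices k ε) :
      smoothingHeight G.height ε (G.movedPt hε v) ∈ G.levels ε ∧
      D (G.movedPt hε v) = G.downDegree v ∧ U (G.movedPt hε v) = G.upDegree v := by
    rw [mem_shortLoopVertices_iff hG, not_or] at hv
    rcases em (G.IsLocalMin v ∨ G.IsDownFork v) with h | h
    · rw [movedPt, if_pos h]
      have h' := hlower v _ (smoothingHeight_lowerPt hε v)
      rw [smoothingHeight_lowerPt]
      exact ⟨sub_mem_levels v, h'.2.1 rfl hv.1,
        h'.1.trans ((hG.isLocalMin_or_isDownFork_iff v).1 h).1.symm⟩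
    · rw [movedPt, if_neg h]
      have h' := hupper v _ (smoothingHeight_upperPt hε v)
      have hv' : G.downDegree v = 1 := by
        rcases hG.2 v with h1 | h1 | h1 | h1
        exacts [absurd (Or.inl h1) h, h1.1, absurd (Or.inr h1) h, h1.1]
      rw [smoothingHeight_upperPt]
      exact ⟨add_mem_levels v, h'.1.trans hv'.symm, h'.2.1 rfl hv.2⟩
  have hne_one (v : G.V) : ¬ (G.upDegree v = 1 ∧ G.downDegree v = 1) := by
    rcases hG.2 v with h | h | h | h <;> rw [h.1, h.2] <;> norm_num
  obtain ⟨H, p, γ, hm, hdeg, hrange⟩ := hc.isArcModel.exists_remove_regular U D _ _ _ _ rfl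
    (fun v => ⟨(hU v.2).symm, (hD v.2).symm⟩)
  refine ⟨H, p, γ, hm, ?_, fun x v hv hx => ?_⟩
  · rw [hrange]
    ext y
    constructor
    · rintro ⟨⟨y, rfl⟩, hreg⟩
      rcases y.2 with ⟨v, hv⟩ | ⟨v, hv⟩
      · have h' := hlower v y.1 hv.symm
        -- An irregular point at a lower level must be the shifted `v` without a loop below, with
        -- down-degree other than one. This leaves local minima and down-forks, which have a single
        -- up-edge and hence no loop above.
        by_cases hy : y.1 ≠ G.lowerPt hε v ∨ G.LoopBelow ε v
        · exact absurd ⟨h'.1, h'.2.2 hy⟩ hreg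
        · push Not at hy
          have hd : G.downDegree v ≠ 1 := fun h =>
            hreg ⟨h'.1, (h'.2.1 hy.1 hy.2).trans h⟩
          have htype : G.IsLocalMin v ∨ G.IsDownFork v := by
            rcases hG.2 v with h1 | h1 | h1 | h1
            exacts [Or.inl h1, absurd h1.1 hd, Or.inr h1, absurd h1.1 hd]
          refine ⟨v, fun hW => ?_, by rw [movedPt, if_pos htype, ← hy.1]⟩
          rw [mem_shortLoopVertices_iff hG] at hW
          exact hW.elim hy.2 (not_loopAbove ((hG.isLocalMin_or_isDownFork_iff v).1 htype).1)
      · have h' := hupper v y.1 hv.symm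
        by_cases hy : y.1 ≠ G.upperPt hε v ∨ G.LoopAbove ε v
        · exact absurd ⟨h'.2.2 hy, h'.1⟩ hreg
        · push Not at hy
          have hd : G.upDegree v ≠ 1 := fun h =>
            hreg ⟨(h'.2.1 hy.1 hy.2).trans h, h'.1⟩
          have htype : ¬ (G.IsLocalMin v ∨ G.IsDownFork v) := fun h =>
            hd ((hG.isLocalMin_or_isDownFork_iff v).1 h).1
          have hv1 : G.downDegree v = 1 := by
            rcases hG.2 v with h1 | h1 | h1 | h1
            exacts [absurd h1.2 hd, h1.1, absurd h1.2 hd, h1.1]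
          refine ⟨v, fun hW => ?_, by rw [movedPt, if_neg htype, ← hy.1]⟩
          rw [mem_shortLoopVertices_iff hG] at hW
          exact hW.elim (not_loopBelow hv1) hy.2
    · rintro ⟨v, hv, rfl⟩
      obtain ⟨h1, h2, h3⟩ := hmoved v hv
      refine ⟨⟨⟨_, h1⟩, rfl⟩, ?_⟩
      rw [h2, h3]
      exact hne_one v
  · obtain ⟨-, h2, h3⟩ := hmoved v hv
    rw [(hdeg x).1, (hdeg x).2, hx]
    exact ⟨h2, h3⟩

end Smoothing

end ReebGraph

theorem theorem3p1 (k : Type w) [Field k] (G : ReebGraph.{u}) (hG : G.IsGeneric)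
    (ε : ℝ) (hε : 0 < ε) (hne : ∀ v w : G.V, 2 * ε ≠ |G.f v - G.f w|) :
    ∃ (H : ReebGraph.{u}) (h : H.Space ≃ₜ Smoothing G.height ε),
      (∀ x : H.Space, smoothingHeight G.height ε (h x) = H.height x) ∧
      H.IsGeneric ∧
      ∃ Φ : {v : G.V // v ∉ G.shortLoopVertices k ε} ≃ H.V,
        ∀ v : {v : G.V // v ∉ G.shortLoopVertices k ε},
          (G.IsLocalMin v.1 ∨ G.IsDownFork v.1 →
            H.f (Φ v) = G.f v.1 - ε ∧
            h (H.vertexPt (Φ v)) =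
              smoothingMk G.height ε (G.vertexPt v.1)
                ⟨-ε, Set.left_mem_Icc.2 (neg_le_self hε.le)⟩) ∧
          (G.IsLocalMax v.1 ∨ G.IsUpFork v.1 →
            H.f (Φ v) = G.f v.1 + ε ∧
            h (H.vertexPt (Φ v)) =
              smoothingMk G.height ε (G.vertexPt v.1)
                ⟨ε, Set.right_mem_Icc.2 (neg_le_self hε.le)⟩) ∧
          H.downDegree (Φ v) = G.downDegree v.1 ∧
          H.upDegree (Φ v) = G.upDegree v.1 := by
  have : T2Space (Smoothing G.height ε) :=
    ReebGraph.t2Space_smoothing hε hG.1 hG.exists_incident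
  obtain ⟨H, p, γ, hm, hrange, hdeg⟩ := ReebGraph.exists_arcModel_smoothing k hG hε hne
  have hinj := ReebGraph.smoothingHeight_movedPt_injective hε hG.1 hne
  let pt : {v : G.V // v ∉ G.shortLoopVertices k ε} → Smoothing G.height ε :=
    fun v => G.movedPt hε v.1
  have hpt : Function.Injective pt := fun v w h =>
    Subtype.ext (hinj (congrArg (smoothingHeight G.height ε) h))
  have hpr : Set.range pt = Set.range p := by
    rw [hrange, Set.image_eq_range]
    rfl
  -- Both sides embed into the smoothing with the same image, so `Φ` matches vertices that give the
  -- same point.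
  let Φ : {v : G.V // v ∉ G.shortLoopVertices k ε} ≃ H.V :=
    (Equiv.ofInjective pt hpt).trans ((Equiv.setCongr hpr).trans
      (Equiv.ofInjective p hm.vertex_injective).symm)
  have hΦ (v : {v : G.V // v ∉ G.shortLoopVertices k ε}) : p (Φ v) = G.movedPt hε v.1 :=
    Equiv.apply_ofInjective_symm hm.vertex_injective _
  have hΦdeg (v : {v : G.V // v ∉ G.shortLoopVertices k ε}) := hdeg (Φ v) v.1 v.2 (hΦ v)
  have hHf (v : {v : G.V // v ∉ G.shortLoopVertices k ε}) :
      H.f (Φ v) = smoothingHeight G.height ε (G.movedPt hε v.1) := by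
    rw [← hΦ, hm.height_vertex]
  refine ⟨H, hm.homeomorph, hm.height_toFun, ⟨?_, fun x => ?_⟩, Φ, fun v => ⟨fun h => ?_,
    fun h => ?_, hΦdeg v⟩⟩
  · intro x y hxy
    obtain ⟨v, rfl⟩ := Φ.surjective x
    obtain ⟨w, rfl⟩ := Φ.surjective y
    rw [hHf, hHf] at hxy
    rw [Subtype.ext (hinj hxy)]
  · obtain ⟨v, rfl⟩ := Φ.surjective x
    have := hG.2 v.1
    rw [ReebGraph.IsLocalMin, ReebGraph.IsUpFork, ReebGraph.IsDownFork, ReebGraph.IsLocalMax,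
      (hΦdeg v).1, (hΦdeg v).2]
    exact this
  · have hp : p (Φ v) = G.lowerPt hε v.1 := by rw [hΦ, ReebGraph.movedPt, if_pos h]
    exact ⟨by rw [← hm.height_vertex, hp, ReebGraph.smoothingHeight_lowerPt], hp⟩
  · have h' : ¬ (G.IsLocalMin v.1 ∨ G.IsDownFork v.1) := fun hcon =>
      ((hG.isLocalMin_or_isDownFork_iff v.1).1 hcon).2
        ((hG.isLocalMax_or_isUpFork_iff v.1).1 h).1
    have hp : p (Φ v) = G.upperPt hε v.1 := by rw [hΦ, ReebGraph.movedPt, if_neg h']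
    exact ⟨by rw [← hm.height_vertex, hp, ReebGraph.smoothingHeight_upperPt], hp⟩
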